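/- Let $n,m\ge 1$ be integers and $0\le\alpha<mn$. Let $\mathcal R$ be the collection of all (open, bounded, non-empty) rectangles in $\mathbb R^n$ with sides parallel to the coordinate axes and, for an $m$-tuple $\vec f=(f_1,\dots,f_m)$ of locally integrable functions on $\mathbb R^n$, let $$\mathcal M_{\mathcal R,\alpha}(\vec f)(x)=\sup_{R\in\mathcal R,\ R\ni x}\ \prod_{i=1}^m\frac{1}{|R|^{1-\frac{\alpha}{mn}}}\int_R|f_i(y)|\,dy,\qquad x\in\mathbb R^n .$$ Let $\log^+t=\max(0,\log t)$ (with $\log^+0=0$, $\log^+\infty=\infty$), let $\Phi_n(t)=t\,[1+(\log^+t)^{n-1}]$ for $t>0$ and $\Phi_n(0)=0$ (the zeroth power being $1$ when $n=1$), and let $\Phi_n^{(m)}$ be the $m$-fold composition of $\Phi_n$ with itself. Then there is a finite constant $C>0$ depending only on $m,n,\alpha$ such that for all such $\vec f$ and all $\lambda>0$, $$\Big|\big\{x\in\mathbb R^n:\mathcal M_{\mathcal R,\alpha}(\vec f)(x)>\lambda^m\big\}\Big|^{m-\frac{\alpha}{n}}\le C\prod_{i=1}^m\Bigg(\bigg[1+\bigg(\frac{\alpha}{mn}\log^+\prod_{j=1}^m\int_{\mathbb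 R^n}\Phi_n^{(m)}\Big(\frac{|f_j(y)|}{\lambda}\Big)dy\bigg)^{n-1}\bigg]^m\int_{\mathbb R^n}\Phi_n^{(m)}\Big(\frac{|f_i(y)|}{\lambda}\Big)dy\Bigg),$$ where both sides take values in $[0,\infty]$ and $0\cdot\infty=0$. -/

import Mathlib

open MeasureTheory
open scoped ENNReal

noncomputable section

/-- The collection of all (nondegenerate, bounded, open) rectangles of `ℝⁿ` with sides parallel to
the coordinate axes. -/
def axisRectangles (n : ℕ) : Set (Set (Fin n → ℝ)) :=
  {R | ∃ a b : Fin n → ℝ, (∀ k, a k < b k) ∧ R = Set.pi Set.univ (fun k => Set.Ioo (a k) (b k))}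

/-- The multilinear fractional strong maximal operator
`M(f₁, …, fₘ)(x) = sup_{R ∋ x} ∏ᵢ |R|^{-(1 - α/(mn))} ∫_R |fᵢ|`, with values in `[0, ∞]`. -/
def fracStrongMaximal {n m : ℕ} (α : ℝ) (f : Fin m → (Fin n → ℝ) → ℂ) (x : Fin n → ℝ) : ℝ≥0∞ :=
  ⨆ R ∈ {R ∈ axisRectangles n | x ∈ R},
    ∏ i, (∫⁻ y in R, ‖f i y‖ₑ) / volume R ^ (1 - α / ((m : ℝ) * (n : ℝ)))

/-- The Young function `Φₙ(t) = t (1 + (log⁺ t)^{n-1})`, used for `t ≥ 0`. -/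
def youngPhi (n : ℕ) (t : ℝ) : ℝ :=
  t * (1 + (Real.posLog t) ^ (n - 1))

/-- The positive part of the logarithm on `[0, ∞]`, with `log⁺ 0 = 0` and `log⁺ ∞ = ∞`. -/
def ennrealPosLog (t : ℝ≥0∞) : ℝ≥0∞ :=
  (ENNReal.log t).toENNReal

/-- The modular `∫ Φₙ^{(m)}(|g(y)| / lam) dy` in `[0, ∞]`, where `Φₙ^{(m)}` is the `m`-fold
composition of `Φₙ` with itself. -/
def youngModular (n m : ℕ) (lam : ℝ) (g : (Fin n → ℝ) → ℂ) : ℝ≥0∞ :=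
  ∫⁻ y, ENNReal.ofReal ((youngPhi n)^[m] (‖g y‖ / lam))

end

/-! Put hᵢ = |fᵢ|/λ, a = α/(mn) and σ = (1 - a)m = m - α/n. The level set is a union of boxes R with
|R|^σ < ∏ᵢ ∫_R hᵢ, and by compactness it is enough to bound the measure V of the union E of finitely
many of them. All maximal operators below run over finite families, with constants independent of
the family.

The Córdoba–Fefferman selection (`exists_selectedList`) extracts a list L, ordered by the length of
the zeroth side, in which each box is at most half covered by the later, longer ones tripled in that
direction. Rejected boxes are half filled by tripled selected ones, so the strong maximal function
gives V ≲ ∑_L |R| (`volume_biUnion_le_sum_of_selected`). On a slice with the zeroth coordinate fixed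
the (n-1)-dimensional sections are sparse (`sparseList_sliceList`), so sums of integrals over them
are controlled by an (n-1)-dimensional strong maximal function. Each directional operator costs one
logarithm, whence the power n-1 in Φₙ (`sum_lintegral_le_of_selectedList`).

Hölder's inequality gives V^σ ≲ ∏ᵢ Yᵢ with Yᵢ = ∑_L ∫_R hᵢ. With yᵢ = V^a Yᵢ / V the product of the
yᵢ is bounded below, while θ yᵢ ≤ K(1 + Φₙ(θ) bᵢ₁) for every θ > 0, where bᵢⱼ is the average over E
of Φₙ^{(j)}(V^a hᵢ). The freedom in θ allows the additive 1 to be absorbed one factor at a time;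
each round costs one more Φₙ, by submultiplicativity and Jensen, hence the m-fold composition
(`exists_prod_le_prod_modular`). Pulling V^a out of the modulars leaves powers of 1 + (a log⁺
V)^(n-1). Since V^σ beats every power of log V, log⁺ V can be traded for log⁺ of the product of the
modulars (`exists_rpow_le_of_rpow_le_log`). -/

open Set Function

/-! ### One-dimensional maximal function -/

/-- The uncentred maximal function on the line over a finite family of intervals. -/
noncomputable def intervalMaximal (P : Finset (ℝ × ℝ)) (g : ℝ → ℝ≥0∞) (t : ℝ) : ℝ≥0∞ :=
  ⨆ p ∈ P, (Ioo p.1 p.2).indicator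
    (fun _ => (∫⁻ s in Ioo p.1 p.2, g s) / ENNReal.ofReal (p.2 - p.1)) t

theorem lt_intervalMaximal_iff {P : Finset (ℝ × ℝ)} {g : ℝ → ℝ≥0∞} {t : ℝ} {c : ℝ≥0∞} :
    c < intervalMaximal P g t ↔ ∃ p ∈ P, t ∈ Ioo p.1 p.2 ∧
      c < (∫⁻ s in Ioo p.1 p.2, g s) / ENNReal.ofReal (p.2 - p.1) := by
  simp only [intervalMaximal, lt_iSup_iff, exists_prop]
  refine exists_congr fun p => and_congr_right fun _ => ?_
  by_cases ht : t ∈ Ioo p.1 p.2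
  · rw [indicator_of_mem ht]; exact (and_iff_right ht).symm
  · rw [indicator_of_notMem ht]
    exact ⟨fun h => absurd h not_lt_zero, fun h => absurd h.1 ht⟩

theorem le_intervalMaximal {P : Finset (ℝ × ℝ)} {g : ℝ → ℝ≥0∞} {t : ℝ} {p : ℝ × ℝ} (hp : p ∈ P)
    (ht : t ∈ Ioo p.1 p.2) :
    (∫⁻ s in Ioo p.1 p.2, g s) / ENNReal.ofReal (p.2 - p.1) ≤ intervalMaximal P g t := by
  have := le_iSup₂ (f := fun (p : ℝ × ℝ) (_ : p ∈ P) => (Ioo p.1 p.2).indicator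
    (fun _ => (∫⁻ s in Ioo p.1 p.2, g s) / ENNReal.ofReal (p.2 - p.1)) t) p hp
  rw [indicator_of_mem ht] at this
  exact this

/-- The weak type `(1,1)` bound of the maximal function on the line. -/
theorem mul_volume_intervalMaximal_le (P : Finset (ℝ × ℝ)) (g : ℝ → ℝ≥0∞) (c : ℝ≥0∞) :
    c * volume {t | c < intervalMaximal P g t} ≤ 5 * ∫⁻ t, g t := by
  classical
  set J : Finset (ℝ × ℝ) := P.filter fun p => p.1 < p.2 ∧
    c < (∫⁻ s in Ioo p.1 p.2, g s) / ENNReal.ofReal (p.2 - p.1) with hJ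
  have hJ1 : ∀ p ∈ J, c * ENNReal.ofReal (p.2 - p.1) ≤ ∫⁻ s in Ioo p.1 p.2, g s := by
    intro p hp
    exact ENNReal.mul_le_of_le_div (Finset.mem_filter.1 hp).2.2.le
  obtain ⟨B, hB⟩ : ∃ B : ℝ, ∀ p ∈ J, (p.2 - p.1) / 2 ≤ B := by
    refine ⟨∑ p ∈ J, (p.2 - p.1) / 2, fun p hp => ?_⟩
    refine Finset.single_le_sum (f := fun p : ℝ × ℝ => (p.2 - p.1) / 2) (fun q hq => ?_) hp
    have := (Finset.mem_filter.1 hq).2.1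
    linarith
  obtain ⟨u, huJ, hud, hucov⟩ :=
    Vitali.exists_disjoint_subfamily_covering_enlargement_closedBall (J : Set (ℝ × ℝ))
      (fun p => (p.1 + p.2) / 2) (fun p => (p.2 - p.1) / 2) B hB 5 (by norm_num)
  obtain ⟨U, rfl⟩ : ∃ U : Finset (ℝ × ℝ), (U : Set (ℝ × ℝ)) = u :=
    ⟨(J.finite_toSet.subset huJ).toFinset, by simp⟩
  have hball : ∀ p : ℝ × ℝ,
      Ioo p.1 p.2 ⊆ Metric.closedBall ((p.1 + p.2) / 2) ((p.2 - p.1) / 2) := by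
    intro p t ht
    rw [Metric.mem_closedBall, Real.dist_eq, abs_le]
    constructor <;> linarith [ht.1, ht.2]
  have hsub : {t | c < intervalMaximal P g t} ⊆
      ⋃ p ∈ U, Metric.closedBall ((p.1 + p.2) / 2) (5 * ((p.2 - p.1) / 2)) := by
    intro t ht
    obtain ⟨p, hp, htp, hc⟩ := lt_intervalMaximal_iff.1 ht
    obtain ⟨q, hq, hpq⟩ := hucov p (Finset.mem_coe.2
      (Finset.mem_filter.2 ⟨hp, htp.1.trans htp.2, hc⟩))
    exact mem_iUnion₂.2 ⟨q, hq, hpq (hball p htp)⟩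
  calc c * volume {t | c < intervalMaximal P g t}
      ≤ c * ∑ p ∈ U, volume (Metric.closedBall ((p.1 + p.2) / 2) (5 * ((p.2 - p.1) / 2))) := by
        gcongr
        exact (measure_mono hsub).trans (measure_biUnion_finset_le _ _)
    _ = 5 * ∑ p ∈ U, c * ENNReal.ofReal (p.2 - p.1) := by
        rw [Finset.mul_sum, Finset.mul_sum]
        refine Finset.sum_congr rfl fun p _ => ?_
        rw [Real.volume_closedBall, show 2 * (5 * ((p.2 - p.1) / 2)) = 5 * (p.2 - p.1) by ring,
          ENNReal.ofReal_mul (by norm_num)]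
        simp only [ENNReal.ofReal_ofNat]
        ring
    _ ≤ 5 * ∑ p ∈ U, ∫⁻ s in Ioo p.1 p.2, g s := by
        gcongr with p hp
        exact hJ1 p (huJ hp)
    _ = 5 * ∫⁻ s in ⋃ p ∈ U, Ioo p.1 p.2, g s := by
        rw [lintegral_biUnion_finset]
        · intro p hp q hq hpq
          exact (hud hp hq hpq).mono (hball p) (hball q)
        · exact fun _ _ => measurableSet_Ioo
    _ ≤ 5 * ∫⁻ t, g t := by
        gcongr
        exact Measure.restrict_le_self

theorem measurable_intervalMaximal (P : Finset (ℝ × ℝ)) (g : ℝ → ℝ≥0∞) :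
    Measurable (intervalMaximal P g) := by
  unfold intervalMaximal
  exact Measurable.biSup _ P.countable_toSet fun p _ => measurable_const.indicator measurableSet_Ioo

/-- The part of `g` below height `c` contributes at most `c` to any average, so an average above `2
* c` forces the part of `g` above `c` to have average above `c`. This form is the one that can be
summed over dyadic levels. -/
theorem mul_volume_intervalMaximal_le_truncated (P : Finset (ℝ × ℝ)) (g : ℝ → ℝ≥0∞) (c : ℝ≥0∞)
    (hc : c ≠ ∞) :
    c * volume {t | 2 * c < intervalMaximal P g t} ≤
      5 * ∫⁻ t, {s | c < g s}.indicator g t := by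
  refine le_trans ?_ (mul_volume_intervalMaximal_le P _ c)
  refine mul_le_mul_right (measure_mono fun t ht => ?_) _
  obtain ⟨p, hp, htp, h⟩ := lt_intervalMaximal_iff.1 ht
  refine lt_intervalMaximal_iff.2 ⟨p, hp, htp, ?_⟩
  have hlen : ENNReal.ofReal (p.2 - p.1) ≠ 0 := by
    simpa using htp.1.trans htp.2
  have h1 : (∫⁻ s in Ioo p.1 p.2, g s) / ENNReal.ofReal (p.2 - p.1) ≤
      (∫⁻ s in Ioo p.1 p.2, {s | c < g s}.indicator g s) / ENNReal.ofReal (p.2 - p.1) + c := by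
    calc (∫⁻ s in Ioo p.1 p.2, g s) / ENNReal.ofReal (p.2 - p.1)
        ≤ (∫⁻ s in Ioo p.1 p.2, ({s | c < g s}.indicator g s + c)) /
          ENNReal.ofReal (p.2 - p.1) := by
          gcongr with s
          by_cases hs : c < g s
          · rw [indicator_of_mem (show s ∈ {s | c < g s} from hs)]
            exact le_self_add
          · exact (not_lt.1 hs).trans le_add_self
      _ = _ := by
          rw [lintegral_add_right _ measurable_const, ENNReal.add_div, setLIntegral_const,
            Real.volume_Ioo, ENNReal.mul_div_cancel_right hlen ENNReal.ofReal_ne_top]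
  have h2 := h.trans_le h1
  rw [two_mul] at h2
  exact (ENNReal.add_lt_add_iff_right hc).1 h2

/-! ### Dyadic substitutes for L (log L)^k -/

/-- A dyadic substitute for the function `t (log⁺ t)^k`. -/
noncomputable def dyadicSum (k : ℕ) (t : ℝ≥0∞) : ℝ≥0∞ :=
  ∑' j : ℕ, (Ioi ((2 : ℝ≥0∞) ^ j)).indicator (fun _ => 2 ^ j * ((j : ℝ≥0∞) + 1) ^ k) t

theorem measurable_dyadicSum (k : ℕ) : Measurable (dyadicSum k) := by
  unfold dyadicSum
  exact Measurable.tsum fun j => measurable_const.indicator measurableSet_Ioi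

theorem dyadicSum_of_le_one (k : ℕ) {t : ℝ≥0∞} (ht : t ≤ 1) : dyadicSum k t = 0 := by
  refine ENNReal.tsum_eq_zero.2 fun j => indicator_of_notMem ?_ _
  exact not_lt.2 (ht.trans (one_le_pow₀ (by norm_num)))

theorem dyadicSum_top (k : ℕ) : dyadicSum k ∞ = ∞ := by
  have h : ∀ j : ℕ, (1 : ℝ≥0∞) ≤ (Ioi ((2 : ℝ≥0∞) ^ j)).indicator
      (fun _ => 2 ^ j * ((j : ℝ≥0∞) + 1) ^ k) ∞ := by
    intro j
    rw [indicator_of_mem (show ∞ ∈ Ioi ((2 : ℝ≥0∞) ^ j) from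
      (ENNReal.pow_ne_top (by norm_num)).lt_top)]
    exact one_le_mul (one_le_pow₀ (by norm_num)) (one_le_pow₀ le_add_self)
  exact top_le_iff.1 ((ENNReal.tsum_const_eq_top_of_ne_zero (α := ℕ) one_ne_zero).symm.trans_le
    (ENNReal.tsum_le_tsum h))

/-- The dyadic scale of a number larger than one. -/
theorem exists_two_pow_lt_le {t : ℝ≥0∞} (ht : 1 < t) (ht' : t ≠ ∞) :
    ∃ N : ℕ, 2 ^ N < t ∧ t ≤ 2 ^ (N + 1) := by
  have hex : ∃ N : ℕ, t ≤ 2 ^ N := by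
    lift t to NNReal using ht'
    obtain ⟨N, hN⟩ := pow_unbounded_of_one_lt t (one_lt_two)
    exact ⟨N, by exact_mod_cast hN.le⟩
  classical
  have h0 : Nat.find hex ≠ 0 := by
    intro h
    have := Nat.find_spec hex
    rw [h, pow_zero] at this
    exact absurd ht (not_lt.2 this)
  refine ⟨Nat.find hex - 1, not_le.1 (Nat.find_min hex (by omega)), ?_⟩
  have := Nat.find_spec hex
  rwa [Nat.sub_add_cancel (by omega)]

theorem indicator_dyadic_eq {N j : ℕ} {t a : ℝ≥0∞} (h1 : 2 ^ N < t) (h2 : t ≤ 2 ^ (N + 1)) :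
    (Ioi ((2 : ℝ≥0∞) ^ j)).indicator (fun _ => a) t = if j ∈ Finset.range (N + 1) then a else 0 := by
  have h12 : (1 : ℝ≥0∞) ≤ 2 := by norm_num
  split_ifs with h <;> rw [Finset.mem_range] at h
  · exact indicator_of_mem (lt_of_le_of_lt (pow_le_pow_right₀ h12 (by omega)) h1) _
  · exact indicator_of_notMem (not_lt.2 (h2.trans (pow_le_pow_right₀ h12 (by omega)))) _

theorem tsum_indicator_dyadic {N : ℕ} {t : ℝ≥0∞} (a : ℕ → ℝ≥0∞) (h1 : 2 ^ N < t)
    (h2 : t ≤ 2 ^ (N + 1)) :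
    ∑' j : ℕ, (Ioi ((2 : ℝ≥0∞) ^ j)).indicator (fun _ => a j) t =
      ∑ j ∈ Finset.range (N + 1), a j := by
  simp_rw [indicator_dyadic_eq h1 h2]
  rw [tsum_eq_sum (s := Finset.range (N + 1)) (fun j hj => if_neg hj)]
  exact Finset.sum_congr rfl fun j hj => if_pos hj

/-- The powers of two below `t` add up to at least `t - 1`. Thus an integral over a set of finite
measure is bounded by that measure plus the integral of a function vanishing wherever `t ≤ 1`. -/
theorem le_one_add_dyadicSum_zero (t : ℝ≥0∞) : t ≤ 1 + dyadicSum 0 t := by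
  rcases le_or_gt t 1 with h | h
  · exact h.trans le_self_add
  rcases eq_or_ne t ∞ with rfl | ht
  · simp [dyadicSum_top]
  obtain ⟨N, h1, h2⟩ := exists_two_pow_lt_le h ht
  rw [dyadicSum, tsum_indicator_dyadic _ h1 h2]
  refine h2.trans (le_of_eq ?_)
  have : ∀ M : ℕ, (2 : ℝ≥0∞) ^ M = 1 + ∑ j ∈ Finset.range M, 2 ^ j * ((j : ℝ≥0∞) + 1) ^ 0 := by
    intro M
    induction M with
    | zero => simp
    | succ M ih =>
      rw [Finset.sum_range_succ, ← add_assoc, ← ih, pow_succ]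
      simp [mul_two]
  exact this _

theorem dyadicSum_le_of_le_two_pow (k N : ℕ) {t : ℝ≥0∞} (h1 : 2 ^ N < t) (h2 : t ≤ 2 ^ (N + 1)) :
    dyadicSum k t ≤ 2 ^ (N + 1) * ((N : ℝ≥0∞) + 1) ^ k := by
  rw [dyadicSum, tsum_indicator_dyadic _ h1 h2]
  have : ∀ M : ℕ, M ≤ N + 1 → ∑ j ∈ Finset.range M, (2 : ℝ≥0∞) ^ j * ((j : ℝ≥0∞) + 1) ^ k ≤
      2 ^ M * ((N : ℝ≥0∞) + 1) ^ k := by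
    intro M
    induction M with
    | zero => simp
    | succ M ih =>
      intro hM
      rw [Finset.sum_range_succ, pow_succ, mul_two, add_mul]
      gcongr
      · exact ih (by omega)
      · omega
  exact this _ le_rfl

theorem dyadicSum_ne_top (k : ℕ) {t : ℝ≥0∞} (ht : t ≠ ∞) : dyadicSum k t ≠ ∞ := by
  rcases le_or_gt t 1 with h | h
  · simp [dyadicSum_of_le_one k h]
  obtain ⟨N, h1, h2⟩ := exists_two_pow_lt_le h ht
  refine ne_top_of_le_ne_top ?_ (dyadicSum_le_of_le_two_pow k N h1 h2)
  exact ENNReal.mul_ne_top (ENNReal.pow_ne_top (by norm_num))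
    (ENNReal.pow_ne_top (by simp))

/-- The source of the extra logarithm: there are `N + 1` dyadic scales below `2 * t`, so the sum is
at most `(N + 1) ^ (k + 1)`, and the last term of the right side alone dominates. -/
theorem mul_tsum_dyadic_le (k : ℕ) (t : ℝ≥0∞) :
    t * ∑' j : ℕ, (Ioi ((2 : ℝ≥0∞) ^ j)).indicator (fun _ => ((j : ℝ≥0∞) + 1) ^ k) (2 * t) ≤
      dyadicSum (k + 1) (2 * t) := by
  rcases le_or_gt (2 * t) 1 with h | h
  · have : ∀ j : ℕ, (Ioi ((2 : ℝ≥0∞) ^ j)).indicator (fun _ => ((j : ℝ≥0∞) + 1) ^ k) (2 * t) = 0 :=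
      fun j => indicator_of_notMem (not_lt.2 (h.trans (one_le_pow₀ (by norm_num)))) _
    simp [this]
  rcases eq_or_ne t ∞ with rfl | ht
  · simp [dyadicSum_top]
  obtain ⟨N, h1, h2⟩ := exists_two_pow_lt_le h (ENNReal.mul_ne_top (by norm_num) ht)
  rw [dyadicSum, tsum_indicator_dyadic _ h1 h2, tsum_indicator_dyadic _ h1 h2]
  have ht2 : t ≤ 2 ^ N := by
    rw [pow_succ', ENNReal.mul_le_mul_iff_right (by norm_num) (by norm_num)] at h2
    exact h2
  calc t * ∑ j ∈ Finset.range (N + 1), ((j : ℝ≥0∞) + 1) ^ k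
      ≤ 2 ^ N * ∑ j ∈ Finset.range (N + 1), ((N : ℝ≥0∞) + 1) ^ k := by
        gcongr with j hj
        exact Nat.lt_succ_iff.1 (Finset.mem_range.1 hj)
    _ = 2 ^ N * ((N : ℝ≥0∞) + 1) ^ (k + 1) := by
        rw [Finset.sum_const, Finset.card_range, nsmul_eq_mul, pow_succ]
        push_cast; ring
    _ ≤ _ := Finset.single_le_sum (f := fun j : ℕ => (2 : ℝ≥0∞) ^ j * ((j : ℝ≥0∞) + 1) ^ (k + 1))
        (fun _ _ => zero_le) (Finset.self_mem_range_succ N)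

theorem lintegral_dyadicSum (k : ℕ) {X : Type*} [MeasurableSpace X] (μ : Measure X)
    {g : X → ℝ≥0∞} (hg : Measurable g) :
    ∫⁻ x, dyadicSum k (g x) ∂μ =
      ∑' j : ℕ, 2 ^ j * ((j : ℝ≥0∞) + 1) ^ k * μ {x | 2 ^ j < g x} := by
  unfold dyadicSum
  rw [lintegral_tsum]
  · refine tsum_congr fun j => ?_
    have : (fun x => (Ioi ((2 : ℝ≥0∞) ^ j)).indicator (fun _ => 2 ^ j * ((j : ℝ≥0∞) + 1) ^ k) (g x))
        = (g ⁻¹' Ioi (2 ^ j)).indicator (fun _ => 2 ^ j * ((j : ℝ≥0∞) + 1) ^ k) := by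
      ext x; rfl
    rw [this, lintegral_indicator_const (hg measurableSet_Ioi)]
    rfl
  · exact fun j => ((measurable_const.indicator measurableSet_Ioi).comp hg).aemeasurable

/-- Each application of the one-dimensional maximal operator costs one logarithm. -/
theorem lintegral_dyadicSum_intervalMaximal_le (k : ℕ) (P : Finset (ℝ × ℝ)) {g : ℝ → ℝ≥0∞}
    (hg : Measurable g) :
    ∫⁻ t, dyadicSum k (intervalMaximal P g t) ≤ 10 * ∫⁻ t, dyadicSum (k + 1) (2 * g t) := by
  rw [lintegral_dyadicSum k _ (measurable_intervalMaximal P g)]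
  have hg2 : Measurable fun t => 2 * g t := hg.const_mul 2
  calc ∑' j : ℕ, 2 ^ j * ((j : ℝ≥0∞) + 1) ^ k * volume {x | 2 ^ j < intervalMaximal P g x}
      ≤ ∑' j : ℕ, 10 * ∫⁻ t, g t *
          (Ioi ((2 : ℝ≥0∞) ^ j)).indicator (fun _ => ((j : ℝ≥0∞) + 1) ^ k) (2 * g t) := by
        refine ENNReal.tsum_le_tsum fun j => ?_
        -- The truncated weak type bound is used at height `2 ^ j / 2`; this accounts for the factor
        -- `2` inside the right side, and for `10 = 2 * 5` in front.
        have h2 : (2 : ℝ≥0∞) * (2 ^ j / 2) = 2 ^ j :=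
          ENNReal.mul_div_cancel (by norm_num) (by norm_num)
        have h := mul_volume_intervalMaximal_le_truncated P g (2 ^ j / 2)
          (ENNReal.div_ne_top (ENNReal.pow_ne_top (by norm_num)) (by norm_num))
        rw [h2] at h
        have hset : ∀ t, {s | 2 ^ j / 2 < g s}.indicator g t * ((j : ℝ≥0∞) + 1) ^ k = g t *
            (Ioi ((2 : ℝ≥0∞) ^ j)).indicator (fun _ => ((j : ℝ≥0∞) + 1) ^ k) (2 * g t) := by
          intro t
          have hiff : 2 ^ j / 2 < g t ↔ (2 : ℝ≥0∞) ^ j < 2 * g t := by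
            rw [ENNReal.div_lt_iff (by norm_num) (by norm_num), mul_comm]
          by_cases ht : 2 ^ j / 2 < g t
          · rw [indicator_of_mem (show t ∈ {s | 2 ^ j / 2 < g s} from ht),
              indicator_of_mem (show 2 * g t ∈ Ioi ((2 : ℝ≥0∞) ^ j) from hiff.1 ht)]
          · rw [indicator_of_notMem (show t ∉ {s | 2 ^ j / 2 < g s} from ht),
              indicator_of_notMem (show 2 * g t ∉ Ioi ((2 : ℝ≥0∞) ^ j) from mt hiff.2 ht)]
            simp
        have hmeas : Measurable ({s | 2 ^ j / 2 < g s}.indicator g) :=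
          hg.indicator (hg measurableSet_Ioi)
        simp_rw [← hset]
        rw [lintegral_mul_const _ hmeas]
        calc 2 ^ j * ((j : ℝ≥0∞) + 1) ^ k * volume {x | 2 ^ j < intervalMaximal P g x}
            = 2 * (2 ^ j / 2 * volume {x | 2 ^ j < intervalMaximal P g x}) *
              ((j : ℝ≥0∞) + 1) ^ k := by
              rw [← mul_assoc 2, h2]; ring
          _ ≤ 2 * (5 * ∫⁻ t, {s | 2 ^ j / 2 < g s}.indicator g t) * ((j : ℝ≥0∞) + 1) ^ k := by
              gcongr
          _ = _ := by ring
    _ = 10 * ∫⁻ t, g t * ∑' j : ℕ,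
          (Ioi ((2 : ℝ≥0∞) ^ j)).indicator (fun _ => ((j : ℝ≥0∞) + 1) ^ k) (2 * g t) := by
        rw [ENNReal.tsum_mul_left, ← lintegral_tsum]
        · simp_rw [ENNReal.tsum_mul_left]
        · exact fun j =>
            (hg.mul ((measurable_const.indicator measurableSet_Ioi).comp hg2)).aemeasurable
    _ ≤ 10 * ∫⁻ t, dyadicSum (k + 1) (2 * g t) := by
        gcongr with t
        exact mul_tsum_dyadic_le k (g t)

/-! ### Iterated directional maximal operators -/

/-- The maximal operator of `intervalMaximal` acting in the `i`-th variable. -/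
noncomputable def dirMaximal {k : ℕ} (P : Finset (ℝ × ℝ)) (i : Fin k) (f : (Fin k → ℝ) → ℝ≥0∞)
    (x : Fin k → ℝ) : ℝ≥0∞ :=
  intervalMaximal P (fun t => f (update x i t)) (x i)

theorem Measurable.dirMaximal {k : ℕ} (P : Finset (ℝ × ℝ)) (i : Fin k)
    {f : (Fin k → ℝ) → ℝ≥0∞} (hf : Measurable f) : Measurable (dirMaximal P i f) := by
  unfold _root_.dirMaximal intervalMaximal
  refine Measurable.biSup _ P.countable_toSet fun p _ => ?_
  have h : Measurable fun x : Fin k → ℝ => ∫⁻ s in Ioo p.1 p.2, f (update x i s) :=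
    Measurable.lintegral_prod_right' (f := fun q : (Fin k → ℝ) × ℝ => f (update q.1 i q.2))
      (hf.comp measurable_update')
  exact (h.div_const _).indicator (measurable_pi_apply i measurableSet_Ioo)

theorem lintegral_dyadicSum_dirMaximal_le {k : ℕ} (r : ℕ) (P : Finset (ℝ × ℝ)) (i : Fin k)
    {f : (Fin k → ℝ) → ℝ≥0∞} (hf : Measurable f) :
    ∫⁻ x, dyadicSum r (dirMaximal P i f x) ≤ 10 * ∫⁻ x, dyadicSum (r + 1) (2 * f x) := by
  have hR : Measurable fun x => dyadicSum (r + 1) (2 * f x) :=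
    (measurable_dyadicSum _).comp (hf.const_mul 2)
  rw [← lintegral_const_mul _ hR]
  refine lintegral_le_of_lmarginal_le {i} ((measurable_dyadicSum r).comp (hf.dirMaximal P i))
    (hR.const_mul 10) fun x => ?_
  rw [lmarginal_singleton, lmarginal_singleton]
  simp only [dirMaximal, update_idem, update_self]
  rw [lintegral_const_mul]
  · exact lintegral_dyadicSum_intervalMaximal_le r P (hf.comp (measurable_update x))
  · exact hR.comp (measurable_update x)

/-- The composition of the directional maximal operators over a list of coordinates. -/
noncomputable def iterMaximal {k : ℕ} (P : Finset (ℝ × ℝ)) (l : List (Fin k))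
    (f : (Fin k → ℝ) → ℝ≥0∞) : (Fin k → ℝ) → ℝ≥0∞ :=
  l.foldr (dirMaximal P) f

theorem iterMaximal_cons {k : ℕ} (P : Finset (ℝ × ℝ)) (i : Fin k) (l : List (Fin k))
    (f : (Fin k → ℝ) → ℝ≥0∞) :
    iterMaximal P (i :: l) f = dirMaximal P i (iterMaximal P l f) := rfl

theorem Measurable.iterMaximal {k : ℕ} (P : Finset (ℝ × ℝ)) (l : List (Fin k))
    {f : (Fin k → ℝ) → ℝ≥0∞} (hf : Measurable f) : Measurable (iterMaximal P l f) := by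
  induction l with
  | nil => exact hf
  | cons i l ih => exact ih.dirMaximal P i

theorem intervalMaximal_const_mul (P : Finset (ℝ × ℝ)) {c : ℝ≥0∞} (hc : c ≠ ∞) (g : ℝ → ℝ≥0∞)
    (t : ℝ) : intervalMaximal P (fun s => c * g s) t = c * intervalMaximal P g t := by
  simp only [intervalMaximal, ENNReal.mul_iSup]
  refine iSup_congr fun p => iSup_congr fun _ => ?_
  by_cases ht : t ∈ Ioo p.1 p.2
  · rw [indicator_of_mem ht, indicator_of_mem ht, lintegral_const_mul' _ _ hc, mul_div_assoc]
  · simp [ht]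

theorem iterMaximal_const_mul {k : ℕ} (P : Finset (ℝ × ℝ)) (l : List (Fin k)) {c : ℝ≥0∞}
    (hc : c ≠ ∞) (f : (Fin k → ℝ) → ℝ≥0∞) (x : Fin k → ℝ) :
    iterMaximal P l (fun y => c * f y) x = c * iterMaximal P l f x := by
  induction l generalizing x with
  | nil => rfl
  | cons i l ih =>
    rw [iterMaximal_cons, iterMaximal_cons, dirMaximal, dirMaximal,
      ← intervalMaximal_const_mul P hc]
    simp_rw [ih]

/-- Each coordinate raises the logarithmic exponent by one; the factor `2` produced inside commutes
with the remaining operators by homogeneity. -/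
theorem lintegral_dyadicSum_iterMaximal_le {k : ℕ} (P : Finset (ℝ × ℝ)) (l : List (Fin k)) :
    ∀ (r : ℕ) {f : (Fin k → ℝ) → ℝ≥0∞}, Measurable f →
      ∫⁻ x, dyadicSum r (iterMaximal P l f x) ≤
        10 ^ l.length * ∫⁻ x, dyadicSum (r + l.length) (2 ^ l.length * f x) := by
  induction l with
  | nil => intro r f _; simp [iterMaximal]
  | cons i l ih =>
    intro r f hf
    calc ∫⁻ x, dyadicSum r (iterMaximal P (i :: l) f x)
        ≤ 10 * ∫⁻ x, dyadicSum (r + 1) (2 * iterMaximal P l f x) :=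
          lintegral_dyadicSum_dirMaximal_le r P i (hf.iterMaximal P l)
      _ = 10 * ∫⁻ x, dyadicSum (r + 1) (iterMaximal P l (fun y => 2 * f y) x) := by
          simp_rw [iterMaximal_const_mul P l (ENNReal.ofNat_ne_top (n := 2))]
      _ ≤ 10 * (10 ^ l.length * ∫⁻ x, dyadicSum (r + 1 + l.length) (2 ^ l.length * (2 * f x))) := by
          gcongr
          exact ih (r + 1) (hf.const_mul 2)
      _ = _ := by
          rw [List.length_cons, ← mul_assoc, ← pow_succ']
          simp_rw [← mul_assoc, ← pow_succ]
          rw [show r + 1 + l.length = r + (l.length + 1) by omega]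

/-- The open box with lower corner `p.1` and upper corner `p.2`. -/
def openBox {k : ℕ} (p : (Fin k → ℝ) × (Fin k → ℝ)) : Set (Fin k → ℝ) :=
  Set.pi univ fun i => Ioo (p.1 i) (p.2 i)

theorem measurableSet_openBox {k : ℕ} (p : (Fin k → ℝ) × (Fin k → ℝ)) :
    MeasurableSet (openBox p) :=
  MeasurableSet.univ_pi fun _ => measurableSet_Ioo

theorem isOpen_openBox {k : ℕ} (p : (Fin k → ℝ) × (Fin k → ℝ)) : IsOpen (openBox p) :=
  isOpen_set_pi finite_univ fun _ _ => isOpen_Ioo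

theorem volume_openBox {k : ℕ} (p : (Fin k → ℝ) × (Fin k → ℝ)) :
    volume (openBox p) = ∏ i, ENNReal.ofReal (p.2 i - p.1 i) := by
  simp [openBox, Real.volume_pi_Ioo]

theorem volume_openBox_ne_top {k : ℕ} (p : (Fin k → ℝ) × (Fin k → ℝ)) :
    volume (openBox p) ≠ ∞ := by
  rw [volume_openBox]
  exact ENNReal.prod_ne_top fun _ _ => ENNReal.ofReal_ne_top

/-- Integrating one variable at a time, each inner integral over a side of the box is its length
times an average, which the directional operator dominates because `x` lies in the box. -/
theorem lmarginal_le_iterMaximal {k : ℕ} (P : Finset (ℝ × ℝ)) {p : (Fin k → ℝ) × (Fin k → ℝ)}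
    (hp : ∀ i, (p.1 i, p.2 i) ∈ P) {f : (Fin k → ℝ) → ℝ≥0∞} (hf : Measurable f)
    (l : List (Fin k)) (hl : l.Nodup) {x : Fin k → ℝ} (hx : x ∈ openBox p) :
    (∫⋯∫⁻_l.toFinset, f ∂fun i => volume.restrict (Ioo (p.1 i) (p.2 i))) x ≤
      (∏ i ∈ l.toFinset, ENNReal.ofReal (p.2 i - p.1 i)) * iterMaximal P l f x := by
  induction l generalizing x with
  | nil => simp [iterMaximal]
  | cons i l ih =>
    have hi : i ∉ l.toFinset := by simpa using (List.nodup_cons.1 hl).1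
    rw [List.toFinset_cons, lmarginal_insert _ hf hi, Finset.prod_insert hi, iterMaximal_cons]
    have hxi : x i ∈ Ioo (p.1 i) (p.2 i) := hx i (mem_univ i)
    calc ∫⁻ t in Ioo (p.1 i) (p.2 i),
          (∫⋯∫⁻_l.toFinset, f ∂fun i => volume.restrict (Ioo (p.1 i) (p.2 i))) (update x i t)
        ≤ ∫⁻ t in Ioo (p.1 i) (p.2 i), (∏ i ∈ l.toFinset, ENNReal.ofReal (p.2 i - p.1 i)) *
            iterMaximal P l f (update x i t) := by
          refine setLIntegral_mono' measurableSet_Ioo fun t ht => ih (List.nodup_cons.1 hl).2 ?_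
          intro j _
          rcases eq_or_ne j i with rfl | hj
          · simpa using ht
          · simpa [update_of_ne hj] using hx j (mem_univ j)
      _ = (∏ i ∈ l.toFinset, ENNReal.ofReal (p.2 i - p.1 i)) *
            ∫⁻ t in Ioo (p.1 i) (p.2 i), iterMaximal P l f (update x i t) :=
          lintegral_const_mul _ ((hf.iterMaximal P l).comp (measurable_update x))
      _ ≤ (∏ i ∈ l.toFinset, ENNReal.ofReal (p.2 i - p.1 i)) *
            (ENNReal.ofReal (p.2 i - p.1 i) * dirMaximal P i (iterMaximal P l f) x) := by
          gcongr
          have h := le_intervalMaximal (g := fun t => iterMaximal P l f (update x i t)) (hp i) hxi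
          rw [mul_comm]
          refine (ENNReal.div_le_iff ?_ ENNReal.ofReal_ne_top).1 h
          simpa using hxi.1.trans hxi.2
      _ = _ := by ring

/-- The composition of all directional maximal operators. -/
noncomputable def strongMaximal {k : ℕ} (P : Finset (ℝ × ℝ)) (f : (Fin k → ℝ) → ℝ≥0∞) :
    (Fin k → ℝ) → ℝ≥0∞ :=
  iterMaximal P (List.finRange k) f

theorem Measurable.strongMaximal {k : ℕ} (P : Finset (ℝ × ℝ))
    {f : (Fin k → ℝ) → ℝ≥0∞} (hf : Measurable f) : Measurable (strongMaximal P f) :=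
  hf.iterMaximal P _

theorem lintegral_openBox_le_strongMaximal {k : ℕ} (P : Finset (ℝ × ℝ))
    {p : (Fin k → ℝ) × (Fin k → ℝ)} (hp : ∀ i, (p.1 i, p.2 i) ∈ P)
    {f : (Fin k → ℝ) → ℝ≥0∞} (hf : Measurable f) {x : Fin k → ℝ} (hx : x ∈ openBox p) :
    ∫⁻ y in openBox p, f y ≤ volume (openBox p) * strongMaximal P f x := by
  have h := lmarginal_le_iterMaximal P hp hf (List.finRange k) (List.nodup_finRange k) hx
  have huniv : (List.finRange k).toFinset = Finset.univ := by ext; simp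
  rw [huniv, lmarginal_univ, ← Measure.restrict_pi_pi] at h
  rw [volume_openBox]
  exact h

theorem lintegral_dyadicSum_zero_strongMaximal_le {k : ℕ} (P : Finset (ℝ × ℝ))
    {f : (Fin k → ℝ) → ℝ≥0∞} (hf : Measurable f) :
    ∫⁻ x, dyadicSum 0 (strongMaximal P f x) ≤ 10 ^ k * ∫⁻ x, dyadicSum k (2 ^ k * f x) := by
  simpa [strongMaximal] using lintegral_dyadicSum_iterMaximal_le P (List.finRange k) 0 hf

/-! ### Half-filled boxes and sparse lists -/

/-- The union of the boxes that are half filled by `A` is controlled by `A`. -/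
theorem volume_biUnion_le_of_half_filled {k : ℕ} (T : Finset ((Fin k → ℝ) × (Fin k → ℝ)))
    {A : Set (Fin k → ℝ)} (hA : MeasurableSet A)
    (hT : ∀ p ∈ T, volume (openBox p) ≤ 2 * volume (openBox p ∩ A)) :
    volume (⋃ p ∈ T, openBox p) ≤ 10 ^ k * dyadicSum k (2 ^ k * 4) * volume A := by
  classical
  set P : Finset (ℝ × ℝ) := T.biUnion fun p => Finset.univ.image fun i => (p.1 i, p.2 i) with hP
  -- With height `4`, a half-filled box has average at least `2`. The maximal function is then at
  -- least `2` on it, and `dyadicSum 0` at least `1`.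
  set f : (Fin k → ℝ) → ℝ≥0∞ := A.indicator fun _ => 4 with hf
  have hfm : Measurable f := measurable_const.indicator hA
  have hlarge : ∀ x ∈ ⋃ p ∈ T, openBox p, 1 ≤ dyadicSum 0 (strongMaximal P f x) := by
    intro x hx
    obtain ⟨p, hp, hxp⟩ := mem_iUnion₂.1 hx
    have hpP : ∀ i, (p.1 i, p.2 i) ∈ P := fun i =>
      Finset.mem_biUnion.2 ⟨p, hp, Finset.mem_image_of_mem _ (Finset.mem_univ i)⟩
    have h := lintegral_openBox_le_strongMaximal P hpP hfm hxp
    rw [lintegral_indicator_const hA, Measure.restrict_apply hA, inter_comm] at h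
    have hv0 : volume (openBox p) ≠ 0 :=
      (isOpen_openBox p).measure_ne_zero _ ⟨x, hxp⟩
    have h2 : 2 ≤ strongMaximal P f x := by
      have h3 : volume (openBox p) * 2 ≤ volume (openBox p) * strongMaximal P f x := by
        refine le_trans ?_ h
        calc volume (openBox p) * 2 ≤ 2 * volume (openBox p ∩ A) * 2 := by
              gcongr; exact hT p hp
          _ = 4 * volume (openBox p ∩ A) := by ring
      exact (ENNReal.mul_le_mul_iff_right hv0 (volume_openBox_ne_top p)).1 h3
    have h4 := le_one_add_dyadicSum_zero (strongMaximal P f x)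
    have h5 : (1 : ℝ≥0∞) + 1 ≤ 1 + dyadicSum 0 (strongMaximal P f x) := by
      refine le_trans ?_ (h2.trans h4); norm_num
    exact (ENNReal.add_le_add_iff_left ENNReal.one_ne_top).1 h5
  calc volume (⋃ p ∈ T, openBox p) = ∫⁻ _ in ⋃ p ∈ T, openBox p, 1 := by simp
    _ ≤ ∫⁻ x in ⋃ p ∈ T, openBox p, dyadicSum 0 (strongMaximal P f x) :=
        setLIntegral_mono ((measurable_dyadicSum 0).comp (hfm.strongMaximal P)) hlarge
    _ ≤ ∫⁻ x, dyadicSum 0 (strongMaximal P f x) := setLIntegral_le_lintegral _ _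
    _ ≤ 10 ^ k * ∫⁻ x, dyadicSum k (2 ^ k * f x) :=
        lintegral_dyadicSum_zero_strongMaximal_le P hfm
    _ = 10 ^ k * ∫⁻ x, A.indicator (fun _ => dyadicSum k (2 ^ k * 4)) x := by
        congr 1
        refine lintegral_congr fun x => ?_
        by_cases hx : x ∈ A
        · simp [hf, hx]
        · simp [hf, hx, dyadicSum_of_le_one]
    _ = _ := by rw [lintegral_indicator_const hA, mul_assoc]

/-- In a sparse list each box is at most half covered by the boxes after it. -/
def SparseList {k : ℕ} (L : List ((Fin k → ℝ) × (Fin k → ℝ))) : Prop :=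
  match L with
  | [] => True
  | p :: L => volume (openBox p ∩ ⋃ q ∈ L, openBox q) ≤ volume (openBox p) / 2 ∧ SparseList L

/-- The part of each box outside the later ones has at least half its measure, and these parts are
pairwise disjoint. Replacing `f` by its average over the box, which is below the maximal function on
that part, turns the overlapping sum into one integral over the union. -/
theorem sum_lintegral_le_of_sparseList {k : ℕ} (L : List ((Fin k → ℝ) × (Fin k → ℝ)))
    (hL : SparseList L) {P : Finset (ℝ × ℝ)} (hP : ∀ p ∈ L, ∀ i, (p.1 i, p.2 i) ∈ P)
    {f : (Fin k → ℝ) → ℝ≥0∞} (hf : Measurable f) :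
    (L.map fun p => ∫⁻ y in openBox p, f y).sum ≤
      2 * ∫⁻ y in ⋃ p ∈ L, openBox p, strongMaximal P f y := by
  induction L with
  | nil => simp
  | cons p L ih =>
    have hmeas : MeasurableSet (⋃ q ∈ L, openBox q) :=
      Finite.measurableSet_biUnion L.finite_toSet fun q _ => measurableSet_openBox q
    have hunion : (⋃ q ∈ p :: L, openBox q) =
        (openBox p \ ⋃ q ∈ L, openBox q) ∪ ⋃ q ∈ L, openBox q := by
      simp
    have hdisj : Disjoint (openBox p \ ⋃ q ∈ L, openBox q) (⋃ q ∈ L, openBox q) :=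
      disjoint_sdiff_left
    rw [List.map_cons, List.sum_cons, hunion, lintegral_union hmeas hdisj, mul_add]
    refine add_le_add ?_ (ih hL.2 fun q hq => hP q (List.mem_cons_of_mem _ hq))
    set E := openBox p \ ⋃ q ∈ L, openBox q with hE
    have hEm : MeasurableSet E := (measurableSet_openBox p).diff hmeas
    rcases eq_or_ne (volume (openBox p)) 0 with h0 | h0
    · rw [setLIntegral_measure_zero _ _ h0]; exact zero_le
    have htop := volume_openBox_ne_top p
    have hEvol : volume (openBox p) / 2 ≤ volume E := by
      have h1 : volume (openBox p) ≤ volume (openBox p) / 2 + volume E := by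
        calc volume (openBox p)
            = volume (openBox p ∩ ⋃ q ∈ L, openBox q) + volume E :=
              (measure_inter_add_sdiff _ hmeas).symm
          _ ≤ _ := by gcongr; exact hL.1
      have h2 : volume (openBox p) / 2 + volume (openBox p) / 2 ≤
          volume (openBox p) / 2 + volume E := by rwa [ENNReal.add_halves]
      exact (ENNReal.add_le_add_iff_left (ENNReal.div_ne_top htop (by norm_num))).1 h2
    calc ∫⁻ y in openBox p, f y
        = volume (openBox p) * ((∫⁻ y in openBox p, f y) / volume (openBox p)) :=
          (ENNReal.mul_div_cancel h0 htop).symm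
      _ ≤ 2 * volume E * ((∫⁻ y in openBox p, f y) / volume (openBox p)) := by
          gcongr
          rw [mul_comm]
          exact (ENNReal.div_le_iff_le_mul (by norm_num) (by norm_num)).1 hEvol
      _ = 2 * ∫⁻ _ in E, (∫⁻ y in openBox p, f y) / volume (openBox p) := by
          rw [setLIntegral_const]; ring
      _ ≤ 2 * ∫⁻ y in E, strongMaximal P f y := by
          gcongr 2 * ?_
          refine setLIntegral_mono (hf.strongMaximal P) fun y hy => ?_
          rw [ENNReal.div_le_iff h0 htop, mul_comm]
          exact lintegral_openBox_le_strongMaximal P (hP p List.mem_cons_self) hf hy.1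

theorem sum_lintegral_le_dyadicSum {k : ℕ} (L : List ((Fin k → ℝ) × (Fin k → ℝ)))
    (hL : SparseList L) {f : (Fin k → ℝ) → ℝ≥0∞} (hf : Measurable f) :
    (L.map fun p => ∫⁻ y in openBox p, f y).sum ≤
      2 * (volume (⋃ p ∈ L, openBox p) + 10 ^ k * ∫⁻ y, dyadicSum k (2 ^ k * f y)) := by
  classical
  set P : Finset (ℝ × ℝ) :=
    L.toFinset.biUnion fun p => Finset.univ.image fun i => (p.1 i, p.2 i) with hP
  refine (sum_lintegral_le_of_sparseList L hL (P := P) (fun p hp i => Finset.mem_biUnion.2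
    ⟨p, List.mem_toFinset.2 hp, Finset.mem_image_of_mem _ (Finset.mem_univ i)⟩) hf).trans ?_
  gcongr
  calc ∫⁻ y in ⋃ p ∈ L, openBox p, strongMaximal P f y
      ≤ ∫⁻ y in ⋃ p ∈ L, openBox p, (1 + dyadicSum 0 (strongMaximal P f y)) :=
        lintegral_mono fun y => le_one_add_dyadicSum_zero _
    _ = volume (⋃ p ∈ L, openBox p) +
          ∫⁻ y in ⋃ p ∈ L, openBox p, dyadicSum 0 (strongMaximal P f y) := by
        rw [lintegral_add_left measurable_const]; simp
    _ ≤ _ := by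
        gcongr
        exact (setLIntegral_le_lintegral _ _).trans (lintegral_dyadicSum_zero_strongMaximal_le P hf)

/-! ### Slicing along the zeroth coordinate -/

theorem measurable_finCons {k : ℕ} :
    Measurable fun q : ℝ × (Fin k → ℝ) => (Fin.cons q.1 q.2 : Fin (k + 1) → ℝ) := by
  refine measurable_pi_iff.2 fun i => ?_
  refine Fin.cases ?_ (fun j => ?_) i
  · simpa using measurable_fst
  · simp only [Fin.cons_succ]
    exact (measurable_pi_apply j).comp measurable_snd

theorem measurePreserving_finCons {k : ℕ} :
    MeasurePreserving (fun q : ℝ × (Fin k → ℝ) => (Fin.cons q.1 q.2 : Fin (k + 1) → ℝ)) := by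
  have h := (volume_preserving_piFinSuccAbove (fun _ : Fin (k + 1) => ℝ) 0).symm
  convert h using 1
  ext q i
  refine Fin.cases ?_ (fun j => ?_) i <;> simp [MeasurableEquiv.piFinSuccAbove]

theorem lintegral_finCons {k : ℕ} {F : (Fin (k + 1) → ℝ) → ℝ≥0∞} (hF : Measurable F) :
    ∫⁻ x, F x = ∫⁻ t, ∫⁻ y, F (Fin.cons t y) := by
  rw [← measurePreserving_finCons.lintegral_comp hF, Measure.volume_eq_prod,
    lintegral_prod (fun q : ℝ × (Fin k → ℝ) => F (Fin.cons q.1 q.2))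
      (hF.comp measurable_finCons).aemeasurable]

theorem finCons_mem_openBox {k : ℕ} {p : (Fin (k + 1) → ℝ) × (Fin (k + 1) → ℝ)} {t : ℝ}
    {y : Fin k → ℝ} : (Fin.cons t y : Fin (k + 1) → ℝ) ∈ openBox p ↔
      t ∈ Ioo (p.1 0) (p.2 0) ∧ y ∈ openBox (Fin.tail p.1, Fin.tail p.2) := by
  simp only [openBox, mem_univ_pi, Fin.forall_fin_succ, Fin.cons_zero, Fin.cons_succ, Fin.tail]

theorem volume_eq_lintegral_slices {k : ℕ} {A : Set (Fin (k + 1) → ℝ)} (hA : MeasurableSet A) :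
    volume A = ∫⁻ t, volume {y : Fin k → ℝ | (Fin.cons t y : Fin (k + 1) → ℝ) ∈ A} := by
  rw [← lintegral_indicator_one hA, lintegral_finCons (measurable_one.indicator hA)]
  refine lintegral_congr fun t => ?_
  have hm : MeasurableSet {y : Fin k → ℝ | (Fin.cons t y : Fin (k + 1) → ℝ) ∈ A} :=
    (measurable_finCons.comp measurable_prodMk_left) hA
  rw [← lintegral_indicator_one hm]
  rfl

theorem setLIntegral_openBox_eq {k : ℕ} (p : (Fin (k + 1) → ℝ) × (Fin (k + 1) → ℝ))
    {F : (Fin (k + 1) → ℝ) → ℝ≥0∞} (hF : Measurable F) :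
    ∫⁻ x in openBox p, F x = ∫⁻ t, (Ioo (p.1 0) (p.2 0)).indicator
      (fun t => ∫⁻ y in openBox (Fin.tail p.1, Fin.tail p.2), F (Fin.cons t y)) t := by
  rw [← lintegral_indicator (measurableSet_openBox p),
    lintegral_finCons (hF.indicator (measurableSet_openBox p))]
  refine lintegral_congr fun t => ?_
  by_cases ht : t ∈ Ioo (p.1 0) (p.2 0)
  · rw [indicator_of_mem ht, ← lintegral_indicator (measurableSet_openBox _)]
    refine lintegral_congr fun y => ?_
    by_cases hy : y ∈ openBox (Fin.tail p.1, Fin.tail p.2)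
    · rw [indicator_of_mem hy, indicator_of_mem (finCons_mem_openBox.2 ⟨ht, hy⟩)]
    · rw [indicator_of_notMem hy, indicator_of_notMem fun h => hy (finCons_mem_openBox.1 h).2]
  · rw [indicator_of_notMem ht]
    refine lintegral_eq_zero_of_ae_eq_zero (Filter.Eventually.of_forall fun y => ?_)
    exact indicator_of_notMem (fun h => ht (finCons_mem_openBox.1 h).1) _

/-! ### The Córdoba–Fefferman selection -/

/-- The box whose zeroth side is enlarged three times about its centre. -/
def widenBox {k : ℕ} (p : (Fin (k + 1) → ℝ) × (Fin (k + 1) → ℝ)) :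
    (Fin (k + 1) → ℝ) × (Fin (k + 1) → ℝ) :=
  (update p.1 0 (p.1 0 - (p.2 0 - p.1 0)), update p.2 0 (p.2 0 + (p.2 0 - p.1 0)))

theorem finCons_mem_widenBox {k : ℕ} {p : (Fin (k + 1) → ℝ) × (Fin (k + 1) → ℝ)} {t : ℝ}
    {y : Fin k → ℝ} : (Fin.cons t y : Fin (k + 1) → ℝ) ∈ openBox (widenBox p) ↔
      t ∈ Ioo (p.1 0 - (p.2 0 - p.1 0)) (p.2 0 + (p.2 0 - p.1 0)) ∧
        y ∈ openBox (Fin.tail p.1, Fin.tail p.2) := by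
  rw [finCons_mem_openBox]
  simp only [widenBox, update_self, Fin.tail_update_zero]

theorem openBox_subset_widenBox {k : ℕ} (p : (Fin (k + 1) → ℝ) × (Fin (k + 1) → ℝ)) :
    openBox p ⊆ openBox (widenBox p) := by
  intro x hx
  rw [← Fin.cons_self_tail x] at hx ⊢
  rw [finCons_mem_openBox] at hx
  rw [finCons_mem_widenBox]
  refine ⟨⟨?_, ?_⟩, hx.2⟩ <;> linarith [hx.1.1, hx.1.2]

theorem volume_widenBox {k : ℕ} (p : (Fin (k + 1) → ℝ) × (Fin (k + 1) → ℝ)) :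
    volume (openBox (widenBox p)) = 3 * volume (openBox p) := by
  rw [volume_openBox, volume_openBox, Fin.prod_univ_succ, Fin.prod_univ_succ]
  simp only [widenBox, update_self, update_of_ne (Fin.succ_ne_zero _)]
  rw [show p.2 0 + (p.2 0 - p.1 0) - (p.1 0 - (p.2 0 - p.1 0)) = 3 * (p.2 0 - p.1 0) by ring,
    ENNReal.ofReal_mul (by norm_num), mul_assoc]
  simp

/-- The lists of boxes produced by the Córdoba–Fefferman selection: each box is no longer in the
zeroth direction than the ones after it, and at most half covered by their enlargements. -/
def SelectedList {k : ℕ} (L : List ((Fin (k + 1) → ℝ) × (Fin (k + 1) → ℝ))) : Prop :=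
  match L with
  | [] => True
  | p :: L => volume (openBox p ∩ ⋃ q ∈ L, openBox (widenBox q)) ≤ volume (openBox p) / 2 ∧
      (∀ q ∈ L, p.2 0 - p.1 0 ≤ q.2 0 - q.1 0) ∧ SelectedList L

theorem exists_selectedList {k : ℕ} (T : Finset ((Fin (k + 1) → ℝ) × (Fin (k + 1) → ℝ))) :
    ∃ L, SelectedList L ∧ (∀ q ∈ L, q ∈ T) ∧
      ∀ p ∈ T, p ∈ L ∨
        volume (openBox p) / 2 ≤ volume (openBox p ∩ ⋃ q ∈ L, openBox (widenBox q)) := by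
  classical
  -- Boxes enter with decreasing zeroth side, so a newly accepted box is the shortest so far and
  -- belongs at the head of the list.
  induction T using Finset.induction_on_min_value 
    (fun p : (Fin (k + 1) → ℝ) × (Fin (k + 1) → ℝ) => p.2 0 - p.1 0) with
  | empty => exact ⟨[], trivial, by simp, by simp⟩
  | insert p T hpT hmin ih =>
    obtain ⟨L, hL, hLT, hcov⟩ := ih
    by_cases hp : volume (openBox p ∩ ⋃ q ∈ L, openBox (widenBox q)) ≤ volume (openBox p) / 2
    · refine ⟨p :: L, ⟨hp, fun q hq => hmin q (hLT q hq), hL⟩, ?_, ?_⟩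
      · intro q hq
        rcases List.mem_cons.1 hq with rfl | hq
        · exact Finset.mem_insert_self _ _
        · exact Finset.mem_insert_of_mem (hLT q hq)
      · intro r hr
        rcases Finset.mem_insert.1 hr with rfl | hr
        · exact Or.inl List.mem_cons_self
        · refine (hcov r hr).imp (List.mem_cons_of_mem _) fun h => h.trans (measure_mono ?_)
          refine inter_subset_inter_right _ (biUnion_mono ?_ fun _ _ => Subset.rfl)
          exact fun q hq => List.mem_cons_of_mem _ hq
    · refine ⟨L, hL, fun q hq => Finset.mem_insert_of_mem (hLT q hq), fun r hr => ?_⟩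
      rcases Finset.mem_insert.1 hr with rfl | hr
      · exact Or.inr (not_le.1 hp).le
      · exact hcov r hr

/-- Every box of `T`, selected or rejected, is at least half filled by the union of the widened
selected boxes, whose measure is at most three times the sum of the measures of the selected boxes.
-/
theorem volume_biUnion_le_sum_of_selected {k : ℕ}
    {T : Finset ((Fin (k + 1) → ℝ) × (Fin (k + 1) → ℝ))}
    {L : List ((Fin (k + 1) → ℝ) × (Fin (k + 1) → ℝ))}
    (hcov : ∀ p ∈ T, p ∈ L ∨
      volume (openBox p) / 2 ≤ volume (openBox p ∩ ⋃ q ∈ L, openBox (widenBox q))) :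
    volume (⋃ p ∈ T, openBox p) ≤ 10 ^ (k + 1) * dyadicSum (k + 1) (2 ^ (k + 1) * 4) * 3 *
      (L.map fun p => volume (openBox p)).sum := by
  have hA : MeasurableSet (⋃ q ∈ L, openBox (widenBox q)) :=
    Finite.measurableSet_biUnion L.finite_toSet fun q _ => measurableSet_openBox _
  refine (volume_biUnion_le_of_half_filled T hA fun p hp => ?_).trans ?_
  · rcases hcov p hp with h | h
    · have hsub : openBox p ⊆ ⋃ q ∈ L, openBox (widenBox q) :=
        (openBox_subset_widenBox p).trans (subset_biUnion_of_mem (u := fun q => openBox (widenBox q)) h)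
      rw [inter_eq_left.2 hsub, two_mul]
      exact le_self_add
    · rw [mul_comm]
      exact (ENNReal.div_le_iff_le_mul (by norm_num) (by norm_num)).1 h
  · rw [mul_assoc _ 3]
    gcongr
    clear hcov hA
    induction L with
    | nil => simp
    | cons p L ih =>
      have hu : (⋃ q ∈ p :: L, openBox (widenBox q)) =
        openBox (widenBox p) ∪ ⋃ q ∈ L, openBox (widenBox q) := by simp
      rw [List.map_cons, List.sum_cons, mul_add, hu]
      refine (measure_union_le _ _).trans (add_le_add (volume_widenBox p).le ih)

open Classical in
/-- The slice at `t` of a list of boxes. -/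
noncomputable def sliceList {k : ℕ} (L : List ((Fin (k + 1) → ℝ) × (Fin (k + 1) → ℝ))) (t : ℝ) :
    List ((Fin k → ℝ) × (Fin k → ℝ)) :=
  (L.filter fun p => t ∈ Ioo (p.1 0) (p.2 0)).map fun p => (Fin.tail p.1, Fin.tail p.2)

theorem sliceList_cons_of_mem {k : ℕ} {p : (Fin (k + 1) → ℝ) × (Fin (k + 1) → ℝ)}
    (L : List ((Fin (k + 1) → ℝ) × (Fin (k + 1) → ℝ))) {t : ℝ} (ht : t ∈ Ioo (p.1 0) (p.2 0)) :
    sliceList (p :: L) t = (Fin.tail p.1, Fin.tail p.2) :: sliceList L t := by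
  rw [sliceList, List.filter_cons_of_pos (by simpa using ht), List.map_cons, sliceList]

theorem sliceList_cons_of_notMem {k : ℕ} {p : (Fin (k + 1) → ℝ) × (Fin (k + 1) → ℝ)}
    (L : List ((Fin (k + 1) → ℝ) × (Fin (k + 1) → ℝ))) {t : ℝ} (ht : t ∉ Ioo (p.1 0) (p.2 0)) :
    sliceList (p :: L) t = sliceList L t := by
  rw [sliceList, List.filter_cons_of_neg (by simpa using ht), sliceList]

theorem mem_biUnion_sliceList {k : ℕ} {L : List ((Fin (k + 1) → ℝ) × (Fin (k + 1) → ℝ))} {t : ℝ}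
    {y : Fin k → ℝ} : y ∈ (⋃ q ∈ sliceList L t, openBox q) ↔
      ∃ p ∈ L, t ∈ Ioo (p.1 0) (p.2 0) ∧ y ∈ openBox (Fin.tail p.1, Fin.tail p.2) := by
  simp only [sliceList, mem_iUnion, List.mem_map, List.mem_filter, decide_eq_true_eq, exists_prop]
  constructor
  · rintro ⟨q, ⟨p, ⟨hp, ht⟩, rfl⟩, hy⟩
    exact ⟨p, hp, ht, hy⟩
  · rintro ⟨p, hp, ht, hy⟩
    exact ⟨_, ⟨p, ⟨hp, ht⟩, rfl⟩, hy⟩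

/-- If the zeroth sides of `p` and of a longer `q` share the point `t`, the tripled side of `q`
contains the whole side of `p`. So the overlap seen on the slice at `t` persists on every slice of
`p`, and the half-covering bound for `p` divides by the length of its zeroth side. -/
theorem sparseList_sliceList {k : ℕ} {L : List ((Fin (k + 1) → ℝ) × (Fin (k + 1) → ℝ))}
    (hL : SelectedList L) (t : ℝ) : SparseList (sliceList L t) := by
  induction L with
  | nil => trivial
  | cons p L ih =>
    by_cases ht : t ∈ Ioo (p.1 0) (p.2 0)
    swap
    · rw [sliceList_cons_of_notMem L ht]; exact ih hL.2.2
    rw [sliceList_cons_of_mem L ht]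
    refine ⟨?_, ih hL.2.2⟩
    set S := openBox (Fin.tail p.1, Fin.tail p.2) with hS
    set U := ⋃ q ∈ sliceList L t, openBox q with hU
    have hlen0 : volume (Ioo (p.1 0) (p.2 0)) ≠ 0 := by
      simpa using ht.1.trans ht.2
    have hlenT : volume (Ioo (p.1 0) (p.2 0)) ≠ ∞ := by simp
    have hA : MeasurableSet (openBox p ∩ ⋃ q ∈ L, openBox (widenBox q)) :=
      (measurableSet_openBox p).inter
        (Finite.measurableSet_biUnion L.finite_toSet fun q _ => measurableSet_openBox _)
    have hlow : volume (Ioo (p.1 0) (p.2 0)) * volume (S ∩ U) ≤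
        volume (openBox p ∩ ⋃ q ∈ L, openBox (widenBox q)) := by
      rw [volume_eq_lintegral_slices hA, mul_comm, ← setLIntegral_const]
      refine (lintegral_mono_ae ?_).trans (setLIntegral_le_lintegral (Ioo (p.1 0) (p.2 0)) _)
      refine (ae_restrict_iff' measurableSet_Ioo).2 (Filter.Eventually.of_forall fun τ hτ => ?_)
      refine measure_mono fun y hy => ?_
      obtain ⟨q, hq, htq, hyq⟩ := mem_biUnion_sliceList.1 hy.2
      refine ⟨finCons_mem_openBox.2 ⟨hτ, hy.1⟩, mem_iUnion₂.2 ⟨q, hq, ?_⟩⟩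
      have hlen := hL.2.1 q hq
      refine finCons_mem_widenBox.2 ⟨⟨?_, ?_⟩, hyq⟩
      · linarith [ht.1, ht.2, hτ.1, hτ.2, htq.1, htq.2]
      · linarith [ht.1, ht.2, hτ.1, hτ.2, htq.1, htq.2]
    have hvol : volume (openBox p) = volume (Ioo (p.1 0) (p.2 0)) * volume S := by
      rw [volume_openBox, hS, volume_openBox, Fin.prod_univ_succ, Real.volume_Ioo]
      rfl
    have h := hlow.trans hL.1
    rw [hvol, mul_div_assoc] at h
    exact (ENNReal.mul_le_mul_iff_right hlen0 hlenT).1 h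

theorem sum_lintegral_eq_lintegral_sliceList {k : ℕ}
    (L : List ((Fin (k + 1) → ℝ) × (Fin (k + 1) → ℝ)))
    {F : (Fin (k + 1) → ℝ) → ℝ≥0∞} (hF : Measurable F) :
    (L.map fun p => ∫⁻ x in openBox p, F x).sum =
      ∫⁻ t, ((sliceList L t).map fun q => ∫⁻ y in openBox q, F (Fin.cons t y)).sum := by
  induction L with
  | nil => simp [sliceList]
  | cons p L ih =>
    rw [List.map_cons, List.sum_cons, ih, setLIntegral_openBox_eq p hF, ← lintegral_add_left]
    · refine lintegral_congr fun t => ?_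
      by_cases ht : t ∈ Ioo (p.1 0) (p.2 0)
      · rw [sliceList_cons_of_mem L ht, indicator_of_mem ht, List.map_cons, List.sum_cons]
      · rw [sliceList_cons_of_notMem L ht, indicator_of_notMem ht, zero_add]
    · refine Measurable.indicator ?_ measurableSet_Ioo
      exact Measurable.lintegral_prod_right'
        (f := fun q : ℝ × (Fin k → ℝ) => F (Fin.cons q.1 q.2)) (hF.comp measurable_finCons)

/-- By Fubini it suffices to apply the sparse bound on each slice. Only `k` of the `k + 1` variables
need a maximal operator, which saves one logarithm over the full strong maximal function. -/
theorem sum_lintegral_le_of_selectedList {k : ℕ}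
    {L : List ((Fin (k + 1) → ℝ) × (Fin (k + 1) → ℝ))} (hL : SelectedList L)
    {F : (Fin (k + 1) → ℝ) → ℝ≥0∞} (hF : Measurable F) :
    (L.map fun p => ∫⁻ x in openBox p, F x).sum ≤
      2 * (volume (⋃ p ∈ L, openBox p) + 10 ^ k * ∫⁻ x, dyadicSum k (2 ^ k * F x)) := by
  have hG : Measurable fun x => dyadicSum k (2 ^ k * F x) :=
    (measurable_dyadicSum k).comp (hF.const_mul _)
  have hU : MeasurableSet (⋃ p ∈ L, openBox p) :=
    Finite.measurableSet_biUnion L.finite_toSet fun q _ => measurableSet_openBox q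
  have hGm : Measurable fun t : ℝ =>
      ∫⁻ y : Fin k → ℝ, dyadicSum k (2 ^ k * F (Fin.cons t y)) :=
    Measurable.lintegral_prod_right'
      (f := fun q : ℝ × (Fin k → ℝ) => dyadicSum k (2 ^ k * F (Fin.cons q.1 q.2)))
      (hG.comp measurable_finCons)
  rw [sum_lintegral_eq_lintegral_sliceList L hF, volume_eq_lintegral_slices hU,
    lintegral_finCons hG, ← lintegral_const_mul _ hGm, ← lintegral_add_right _ (hGm.const_mul _),
    ← lintegral_const_mul' _ _ (by norm_num)]
  refine lintegral_mono fun t => ?_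
  have hset : {y : Fin k → ℝ | (Fin.cons t y : Fin (k + 1) → ℝ) ∈ ⋃ p ∈ L, openBox p} =
      ⋃ q ∈ sliceList L t, openBox q := by
    ext y
    rw [mem_biUnion_sliceList]
    simp only [mem_ofPred_eq, mem_iUnion, exists_prop, finCons_mem_openBox]
  rw [hset]
  exact sum_lintegral_le_dyadicSum _ (sparseList_sliceList hL t)
    (hF.comp (measurable_finCons.comp measurable_prodMk_left))

/-! ### The Young function and its iterates -/

theorem log_le_posLog (x : ℝ) : Real.log x ≤ Real.posLog x :=
  le_max_right _ _

theorem one_add_add_pow_le {x y : ℝ} (hx : 0 ≤ x) (hy : 0 ≤ y) (p : ℕ) :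
    1 + (x + y) ^ p ≤ 2 ^ p * ((1 + x ^ p) * (1 + y ^ p)) := by
  have h1 : (x + y) ^ p ≤ 2 ^ p * (x ^ p + y ^ p) := by
    refine (add_pow_le hx hy p).trans ?_
    gcongr
    · norm_num
    · omega
  have h2 : (1 : ℝ) ≤ 2 ^ p := one_le_pow₀ (by norm_num)
  have h3 : 0 ≤ 2 ^ p * (x ^ p * y ^ p) := by positivity
  nlinarith

theorem youngPhi_nonneg (n : ℕ) {t : ℝ} (ht : 0 ≤ t) : 0 ≤ youngPhi n t := by
  have := Real.posLog_nonneg (x := t)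
  unfold youngPhi
  positivity

theorem le_youngPhi (n : ℕ) {t : ℝ} (ht : 0 ≤ t) : t ≤ youngPhi n t := by
  have := Real.posLog_nonneg (x := t)
  refine le_mul_of_one_le_right ht (le_add_of_nonneg_right (by positivity))

theorem youngPhi_mono (n : ℕ) {s t : ℝ} (hs : 0 ≤ s) (hst : s ≤ t) :
    youngPhi n s ≤ youngPhi n t := by
  have h0 := Real.posLog_nonneg (x := s)
  have h1 := Real.posLog_le_posLog hs hst
  have h2 := hs.trans hst
  unfold youngPhi
  gcongr

theorem youngPhi_mul_le (n : ℕ) {s t : ℝ} (hs : 0 ≤ s) (ht : 0 ≤ t) :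
    youngPhi n (s * t) ≤ 2 ^ (n - 1) * (youngPhi n s * youngPhi n t) := by
  have hs0 := Real.posLog_nonneg (x := s)
  have ht0 := Real.posLog_nonneg (x := t)
  have hst := Real.posLog_nonneg (x := s * t)
  calc youngPhi n (s * t)
      ≤ s * t * (1 + (Real.posLog s + Real.posLog t) ^ (n - 1)) := by
        unfold youngPhi
        gcongr
        exact Real.posLog_mul
    _ ≤ s * t * (2 ^ (n - 1) * ((1 + Real.posLog s ^ (n - 1)) * (1 + Real.posLog t ^ (n - 1)))) := by
        gcongr
        exact one_add_add_pow_le hs0 ht0 _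
    _ = _ := by unfold youngPhi; ring

theorem measurable_youngPhi (n : ℕ) : Measurable (youngPhi n) := by
  unfold youngPhi Real.posLog
  fun_prop

theorem measurable_youngPhi_iterate (n j : ℕ) : Measurable ((youngPhi n)^[j]) :=
  (measurable_youngPhi n).iterate j

theorem youngPhi_iterate_nonneg (n j : ℕ) {t : ℝ} (ht : 0 ≤ t) : 0 ≤ (youngPhi n)^[j] t := by
  induction j with
  | zero => exact ht
  | succ j ih => rw [iterate_succ_apply']; exact youngPhi_nonneg n ih

theorem youngPhi_iterate_le_succ (n j : ℕ) {t : ℝ} (ht : 0 ≤ t) :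
    (youngPhi n)^[j] t ≤ (youngPhi n)^[j + 1] t := by
  rw [iterate_succ_apply']
  exact le_youngPhi n (youngPhi_iterate_nonneg n j ht)

theorem youngPhi_iterate_mono_index (n : ℕ) {i j : ℕ} (hij : i ≤ j) {t : ℝ} (ht : 0 ≤ t) :
    (youngPhi n)^[i] t ≤ (youngPhi n)^[j] t :=
  monotone_nat_of_le_succ (f := fun j => (youngPhi n)^[j] t)
    (fun j => youngPhi_iterate_le_succ n j ht) hij

/-- Submultiplicativity up to a constant survives composition; it is what separates `V ^ a` from the
data inside the modular. -/
theorem exists_youngPhi_iterate_mul_le (n j : ℕ) : ∃ K : ℝ, 0 < K ∧ ∀ s t : ℝ, 0 ≤ s → 0 ≤ t →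
    (youngPhi n)^[j] (s * t) ≤ K * ((youngPhi n)^[j] s * (youngPhi n)^[j] t) := by
  induction j with
  | zero => exact ⟨1, one_pos, fun s t _ _ => by simp⟩
  | succ j ih =>
    obtain ⟨K, hK, h⟩ := ih
    have hφK : 0 < youngPhi n K := hK.trans_le (le_youngPhi n hK.le)
    refine ⟨2 ^ (n - 1) * (youngPhi n K * 2 ^ (n - 1)), by positivity, fun s t hs ht => ?_⟩
    simp only [iterate_succ_apply']
    have hs' := youngPhi_iterate_nonneg n j hs
    have ht' := youngPhi_iterate_nonneg n j ht
    calc youngPhi n ((youngPhi n)^[j] (s * t))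
        ≤ youngPhi n (K * ((youngPhi n)^[j] s * (youngPhi n)^[j] t)) :=
          youngPhi_mono n (youngPhi_iterate_nonneg n j (mul_nonneg hs ht)) (h s t hs ht)
      _ ≤ 2 ^ (n - 1) * (youngPhi n K * youngPhi n ((youngPhi n)^[j] s * (youngPhi n)^[j] t)) :=
          youngPhi_mul_le n hK.le (mul_nonneg hs' ht')
      _ ≤ 2 ^ (n - 1) * (youngPhi n K * (2 ^ (n - 1) *
            (youngPhi n ((youngPhi n)^[j] s) * youngPhi n ((youngPhi n)^[j] t)))) := by
          gcongr
          exact youngPhi_mul_le n hs' ht'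
      _ = _ := by ring

theorem posLog_one_add_pow_le (p : ℕ) {L : ℝ} (hL : 0 ≤ L) :
    Real.posLog (1 + L ^ p) ≤ 1 + p * L := by
  have h1 : 1 + L ^ p ≤ 2 * (1 + L) ^ p := by
    have ha : 1 ≤ (1 + L) ^ p := one_le_pow₀ (by linarith)
    have hb : L ^ p ≤ (1 + L) ^ p := by gcongr; linarith
    linarith
  refine (Real.posLog_le_posLog (by positivity) h1).trans (Real.posLog_mul.trans ?_)
  have h2 : Real.posLog 2 ≤ 1 := by
    rw [Real.posLog_eq_log (by norm_num)]
    linarith [Real.log_two_lt_d9]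
  have h3 : Real.posLog ((1 + L) ^ p) ≤ p * L := by
    rw [Real.posLog_pow, Real.posLog_eq_log (by rw [abs_of_pos (by linarith)]; linarith)]
    gcongr
    have := Real.log_le_sub_one_of_pos (x := 1 + L) (by linarith)
    linarith
  exact add_le_add h2 h3

/-- The logarithm of `t (1 + (log⁺ t)^p)^j` is still of order `1 + log⁺ t`, so every further
composition contributes one more factor of the same kind. -/
theorem exists_youngPhi_iterate_le (n j : ℕ) : ∃ C : ℝ, 0 < C ∧ ∀ t : ℝ, 0 ≤ t →
    (youngPhi n)^[j] t ≤ C * (t * (1 + Real.posLog t ^ (n - 1)) ^ j) := by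
  induction j with
  | zero => exact ⟨1, one_pos, fun t _ => by simp⟩
  | succ j ih =>
    obtain ⟨C, hC, h⟩ := ih
    set p := n - 1 with hp
    have hpC := Real.posLog_nonneg (x := C)
    set A : ℝ := Real.posLog C + 1 + j * (1 + p) with hA
    have hA0 : 0 ≤ A := by positivity
    refine ⟨C * (1 + A ^ p * 2 ^ p), by positivity, fun t ht => ?_⟩
    set L := Real.posLog t with hLdef
    have hL : 0 ≤ L := Real.posLog_nonneg
    set u := 1 + L ^ p with hu
    have hu0 : 0 ≤ u := by positivity
    have hlog : Real.posLog (C * (t * u ^ j)) ≤ A * (1 + L) := by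
      have h1 : Real.posLog (C * (t * u ^ j)) ≤
          Real.posLog C + (L + j * Real.posLog u) := by
        refine Real.posLog_mul.trans (add_le_add le_rfl ?_)
        rw [← Real.posLog_pow]
        exact Real.posLog_mul
      have h2 := mul_le_mul_of_nonneg_left (posLog_one_add_pow_le p hL) (Nat.cast_nonneg (α := ℝ) j)
      rw [← hu] at h2
      have h3 : 0 ≤ (j : ℝ) * L := by positivity
      have h4 : 0 ≤ (j : ℝ) * p := by positivity
      have h5 : 0 ≤ Real.posLog C * L := by positivity
      rw [hA]
      nlinarith
    rw [iterate_succ_apply']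
    calc youngPhi n ((youngPhi n)^[j] t)
        ≤ youngPhi n (C * (t * u ^ j)) :=
          youngPhi_mono n (youngPhi_iterate_nonneg n j ht) (h t ht)
      _ = C * (t * u ^ j) * (1 + Real.posLog (C * (t * u ^ j)) ^ p) := rfl
      _ ≤ C * (t * u ^ j) * (1 + (A * (1 + L)) ^ p) := by
          gcongr
          exact Real.posLog_nonneg
      _ ≤ C * (t * u ^ j) * ((1 + A ^ p * 2 ^ p) * u) := by
          gcongr
          have h6 : (1 + L) ^ p ≤ 2 ^ p * u := by
            refine (add_pow_le zero_le_one hL p).trans ?_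
            rw [one_pow]
            gcongr
            · norm_num
            · omega
          have h7 : 1 ≤ u := le_add_of_nonneg_right (by positivity)
          rw [mul_pow]
          have h8 := mul_le_mul_of_nonneg_left h6 (pow_nonneg hA0 p)
          nlinarith
      _ = _ := by rw [pow_succ]; ring

theorem dyadicSum_ofReal_le (k : ℕ) {t : ℝ} (ht : 0 ≤ t) :
    dyadicSum k (ENNReal.ofReal t) ≤ ENNReal.ofReal (2 * 4 ^ k * youngPhi (k + 1) t) := by
  rcases le_or_gt (ENNReal.ofReal t) 1 with h | h
  · rw [dyadicSum_of_le_one k h]; exact zero_le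
  obtain ⟨N, h1, h2⟩ := exists_two_pow_lt_le h ENNReal.ofReal_ne_top
  refine (dyadicSum_le_of_le_two_pow k N h1 h2).trans ?_
  have hN : (2 : ℝ) ^ N < t := by
    have : ENNReal.ofReal (2 ^ N) < ENNReal.ofReal t := by
      rwa [ENNReal.ofReal_pow (by norm_num), ENNReal.ofReal_ofNat]
    exact (ENNReal.ofReal_lt_ofReal_iff_of_nonneg (by positivity)).1 this
  have hcast : (2 : ℝ≥0∞) ^ (N + 1) * ((N : ℝ≥0∞) + 1) ^ k =
      ENNReal.ofReal (2 ^ (N + 1) * ((N : ℝ) + 1) ^ k) := by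
    rw [ENNReal.ofReal_mul (by positivity), ENNReal.ofReal_pow (by norm_num),
      ENNReal.ofReal_pow (by positivity), ENNReal.ofReal_add (by positivity) (by norm_num)]
    simp
  rw [hcast]
  refine ENNReal.ofReal_le_ofReal ?_
  set L := Real.posLog t with hLdef
  have hL : 0 ≤ L := Real.posLog_nonneg
  -- The factor `2` comes from `log 2 > 1 / 2`.
  have hNL : (N : ℝ) ≤ 2 * L := by
    have h3 : (N : ℝ) * Real.log 2 ≤ L := by
      rw [← Real.log_pow]
      exact (Real.log_le_log (by positivity) hN.le).trans (log_le_posLog _)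
    have h4 := Real.log_two_gt_d9
    have h5 : (0 : ℝ) ≤ N := Nat.cast_nonneg N
    nlinarith
  have h6 : ((N : ℝ) + 1) ^ k ≤ 4 ^ k * (1 + L ^ k) := by
    calc ((N : ℝ) + 1) ^ k ≤ (2 * (1 + L)) ^ k := by gcongr; linarith
      _ = 2 ^ k * (1 + L) ^ k := mul_pow _ _ _
      _ ≤ 2 ^ k * (2 ^ k * (1 + L ^ k)) := by
          gcongr
          refine (add_pow_le zero_le_one hL k).trans ?_
          rw [one_pow]
          gcongr
          · norm_num
          · omega
      _ = _ := by rw [← mul_assoc, ← mul_pow]; norm_num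
  calc (2 : ℝ) ^ (N + 1) * ((N : ℝ) + 1) ^ k ≤ (2 * t) * (4 ^ k * (1 + L ^ k)) := by
        rw [pow_succ']
        gcongr
    _ = _ := by rw [youngPhi, Nat.add_sub_cancel]; ring

/-- Jensen's inequality for `youngPhi`, up to a constant. -/
theorem youngPhi_integral_le (n : ℕ) {X : Type*} [MeasurableSpace X] (ν : Measure X)
    [IsProbabilityMeasure ν] {h : X → ℝ} (h0 : ∀ x, 0 ≤ h x) (hint : Integrable h ν)
    (hφ : Integrable (fun x => youngPhi n (h x)) ν) :
    youngPhi n (∫ x, h x ∂ν) ≤ 2 ^ (n - 1) * youngPhi n 2 * ∫ x, youngPhi n (h x) ∂ν := by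
  set u := ∫ x, h x ∂ν with hu
  have hu0 : 0 ≤ u := integral_nonneg h0
  set w := 1 + Real.posLog (u / 2) ^ (n - 1) with hw
  have hw0 : 0 ≤ w := by
    have := Real.posLog_nonneg (x := u / 2)
    positivity
  -- A substitute for a supporting line, avoiding convexity: only monotonicity of the logarithmic
  -- factor is used. Centring at half the mean makes the left side integrate to `youngPhi n (u /
  -- 2)`; the lost factor `2` is restored by submultiplicativity.
  have hpt : ∀ x, w * (h x - u / 2) ≤ youngPhi n (h x) := by
    intro x
    rcases le_or_gt (u / 2) (h x) with hx | hx
    · have h1 : Real.posLog (u / 2) ≤ Real.posLog (h x) :=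
        Real.posLog_le_posLog (by positivity) hx
      have h2 := Real.posLog_nonneg (x := u / 2)
      have h3 : w ≤ 1 + Real.posLog (h x) ^ (n - 1) := by rw [hw]; gcongr
      calc w * (h x - u / 2) ≤ w * h x := by gcongr; linarith
        _ ≤ (1 + Real.posLog (h x) ^ (n - 1)) * h x := mul_le_mul_of_nonneg_right h3 (h0 x)
        _ = _ := mul_comm _ _
    · exact (mul_nonpos_of_nonneg_of_nonpos hw0 (by linarith)).trans (youngPhi_nonneg n (h0 x))
  have hle : youngPhi n (u / 2) ≤ ∫ x, youngPhi n (h x) ∂ν := by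
    calc youngPhi n (u / 2) = ∫ x, w * (h x - u / 2) ∂ν := by
          rw [integral_const_mul, integral_sub hint (integrable_const _), integral_const, ← hu]
          simp only [probReal_univ, one_smul]
          rw [youngPhi, ← hw]; ring
      _ ≤ _ := integral_mono ((hint.sub (integrable_const _)).const_mul w) hφ hpt
  have h2 : 0 ≤ youngPhi n 2 := youngPhi_nonneg n (by norm_num)
  calc youngPhi n u = youngPhi n (2 * (u / 2)) := by congr 1; ring
    _ ≤ 2 ^ (n - 1) * (youngPhi n 2 * youngPhi n (u / 2)) :=
        youngPhi_mul_le n (by norm_num) (by positivity)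
    _ ≤ 2 ^ (n - 1) * (youngPhi n 2 * ∫ x, youngPhi n (h x) ∂ν) := by gcongr
    _ = _ := by ring

/-! ### Exchanging the logarithm of the unknown -/

/-- A logarithmic factor of the unknown on the right can be replaced by one of the datum. -/
theorem exists_rpow_le_of_rpow_le_log (p M : ℕ) {σ a C : ℝ} (hσ : 0 < σ) (ha : 0 ≤ a)
    (hC : 0 < C) : ∃ C' : ℝ, 0 < C' ∧ ∀ V B : ℝ, 0 < V → 0 ≤ B →
      V ^ σ ≤ C * ((1 + (a * Real.posLog V) ^ p) ^ M * B) →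
      V ^ σ ≤ C' * ((1 + (a * Real.posLog B) ^ p) ^ M * B) := by
  -- Chosen so that the `p * M` logarithms together cost at most `V ^ (σ / 2)`; the `+ 1` covers `p
  -- * M = 0`.
  set ε : ℝ := σ / (2 * (p * M + 1)) with hε
  have hε0 : 0 < ε := by positivity
  set C1 : ℝ := (1 + (a / ε) ^ p) ^ M with hC1
  have hC10 : 0 < C1 := by positivity
  have hposC := Real.posLog_nonneg (x := C * C1)
  set D : ℝ := 2 / σ * Real.posLog (C * C1) with hD
  have hD0 : 0 ≤ D := by positivity
  set C2 : ℝ := 2 ^ p * ((1 + (a * D) ^ p) * (1 + (2 / σ) ^ p)) with hC2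
  have hC20 : 0 < C2 := by positivity
  refine ⟨C * (2 ^ M + C2 ^ M), by positivity, fun V B hV hB h => ?_⟩
  have hLB : 0 ≤ Real.posLog B := Real.posLog_nonneg
  suffices hu : (1 + (a * Real.posLog V) ^ p) ^ M ≤
      (2 ^ M + C2 ^ M) * (1 + (a * Real.posLog B) ^ p) ^ M by
    refine h.trans ?_
    rw [mul_assoc C, ← mul_assoc (2 ^ M + C2 ^ M)]
    gcongr
  have hone : 1 ≤ 1 + (a * Real.posLog B) ^ p := le_add_of_nonneg_right (by positivity)
  have hLV : 0 ≤ Real.posLog V := Real.posLog_nonneg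
  -- For `V ≤ 1` the logarithm vanishes, but `0 ^ p` is `1` when `p = 0`, hence the bound `2 ^ M`.
  rcases le_or_gt V 1 with hV1 | hV1
  · have h0 : Real.posLog V = 0 := Real.posLog_eq_zero_iff _ |>.2 (by rwa [abs_of_pos hV])
    have h1 : (1 + (a * Real.posLog V) ^ p) ^ M ≤ 2 ^ M := by
      rw [h0, mul_zero]
      gcongr
      have : (0 : ℝ) ^ p ≤ 1 := pow_le_one₀ le_rfl zero_le_one
      linarith
    calc (1 + (a * Real.posLog V) ^ p) ^ M ≤ 2 ^ M * 1 := by rwa [mul_one]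
      _ ≤ _ := by
        gcongr
        · exact le_add_of_nonneg_right (by positivity)
        · exact one_le_pow₀ hone
  have hlogV : Real.posLog V = Real.log V :=
    Real.posLog_eq_log (by rw [abs_of_pos hV]; exact hV1.le)
  have hVε1 : 1 ≤ (V ^ ε) ^ p := one_le_pow₀ (Real.one_le_rpow hV1.le hε0.le)
  have hgrow : (1 + (a * Real.posLog V) ^ p) ^ M ≤ C1 * V ^ (σ / 2) := by
    calc (1 + (a * Real.posLog V) ^ p) ^ M
        ≤ (1 + (a * (V ^ ε / ε)) ^ p) ^ M := by
          gcongr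
          rw [hlogV]
          exact Real.log_le_rpow_div hV.le hε0
      _ = (1 + (a / ε) ^ p * (V ^ ε) ^ p) ^ M := by
          rw [← mul_pow]; congr 3; ring
      _ ≤ ((1 + (a / ε) ^ p) * (V ^ ε) ^ p) ^ M := by
          gcongr
          rw [add_mul, one_mul]
          gcongr
      _ = C1 * V ^ (ε * (p * M)) := by
          rw [mul_pow, ← pow_mul, ← Real.rpow_natCast (V ^ ε), ← Real.rpow_mul hV.le]
          push_cast
          rfl
      _ ≤ C1 * V ^ (σ / 2) := by
          gcongr
          · exact hV1.le
          · rw [hε, div_mul_eq_mul_div, div_le_div_iff₀ (by positivity) (by norm_num)]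
            nlinarith
  -- A crude power bound of `V` by `B`; its logarithm is all that is needed to compare `log⁺ V` with
  -- `log⁺ B`.
  have hhalf : V ^ (σ / 2) ≤ C * C1 * B := by
    have h1 : V ^ (σ / 2) * V ^ (σ / 2) ≤ C * C1 * B * V ^ (σ / 2) := by
      rw [← Real.rpow_add hV, add_halves]
      refine h.trans ?_
      calc C * ((1 + (a * Real.posLog V) ^ p) ^ M * B) ≤ C * (C1 * V ^ (σ / 2) * B) := by gcongr
        _ = _ := by ring
    exact le_of_mul_le_mul_right h1 (Real.rpow_pos_of_pos hV _)
  have hlog : Real.posLog V ≤ D + 2 / σ * Real.posLog B := by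
    have h1 : σ / 2 * Real.posLog V ≤ Real.posLog (C * C1) + Real.posLog B := by
      rw [hlogV, ← Real.log_rpow hV]
      refine (log_le_posLog (V ^ (σ / 2))).trans ((Real.posLog_le_posLog (by positivity) hhalf).trans ?_)
      exact Real.posLog_mul
    calc Real.posLog V = 2 / σ * (σ / 2 * Real.posLog V) := by field_simp
      _ ≤ 2 / σ * (Real.posLog (C * C1) + Real.posLog B) := by gcongr
      _ = _ := by rw [hD]; ring
  have hfin : 1 + (a * Real.posLog V) ^ p ≤ C2 * (1 + (a * Real.posLog B) ^ p) := by
    calc 1 + (a * Real.posLog V) ^ p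
        ≤ 1 + (a * D + 2 / σ * (a * Real.posLog B)) ^ p := by
          gcongr
          calc a * Real.posLog V ≤ a * (D + 2 / σ * Real.posLog B) := by gcongr
            _ = _ := by ring
      _ ≤ 2 ^ p * ((1 + (a * D) ^ p) * (1 + (2 / σ * (a * Real.posLog B)) ^ p)) :=
          one_add_add_pow_le (by positivity) (by positivity) p
      _ ≤ 2 ^ p * ((1 + (a * D) ^ p) * ((1 + (2 / σ) ^ p) * (1 + (a * Real.posLog B) ^ p))) := by
          gcongr
          rw [mul_pow]
          have h3 : 0 ≤ (2 / σ) ^ p := by positivity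
          have h4 : 0 ≤ (a * Real.posLog B) ^ p := by positivity
          nlinarith
      _ = _ := by rw [hC2]; ring
  calc (1 + (a * Real.posLog V) ^ p) ^ M ≤ (C2 * (1 + (a * Real.posLog B) ^ p)) ^ M := by gcongr
    _ = C2 ^ M * (1 + (a * Real.posLog B) ^ p) ^ M := mul_pow _ _ _
    _ ≤ _ := by
      gcongr
      exact le_add_of_nonneg_left (by positivity)

/-! ### Absorption in a product of factors -/

theorem youngPhi_pos (n : ℕ) {t : ℝ} (ht : 0 < t) : 0 < youngPhi n t :=
  ht.trans_le (le_youngPhi n ht.le)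

theorem youngPhi_prod_le (n : ℕ) {ι : Type*} (s : Finset ι) {x : ι → ℝ} (hx : ∀ i ∈ s, 0 ≤ x i) :
    youngPhi n (∏ i ∈ s, x i) ≤
      (2 ^ (n - 1)) ^ s.card * (youngPhi n 1 * ∏ i ∈ s, youngPhi n (x i)) := by
  classical
  induction s using Finset.induction_on with
  | empty => simp
  | insert i s hi ih =>
    rw [Finset.prod_insert hi, Finset.prod_insert hi, Finset.card_insert_of_notMem hi]
    have hxi := hx i (Finset.mem_insert_self i s)
    have hxs : ∀ j ∈ s, 0 ≤ x j := fun j hj => hx j (Finset.mem_insert_of_mem hj)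
    have := youngPhi_nonneg n hxi
    calc youngPhi n (x i * ∏ j ∈ s, x j)
        ≤ 2 ^ (n - 1) * (youngPhi n (x i) * youngPhi n (∏ j ∈ s, x j)) :=
          youngPhi_mul_le n hxi (Finset.prod_nonneg hxs)
      _ ≤ 2 ^ (n - 1) * (youngPhi n (x i) *
            ((2 ^ (n - 1)) ^ s.card * (youngPhi n 1 * ∏ j ∈ s, youngPhi n (x j)))) := by
          gcongr
          exact ih hxs
      _ = _ := by ring

/-- Passage from the Luxemburg type bounds `hlux` for the factors, to a bound for their product by
the product of the iterated modulars `b i r`. -/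
theorem exists_prod_le_prod_modular (n : ℕ) {K : ℝ} (hK : 0 < K) (ι : Type*) (r : ℕ) :
    ∀ c : ℝ, 0 < c → ∃ C : ℝ, 0 < C ∧ ∀ (s : Finset ι) (y : ι → ℝ) (b : ι → ℕ → ℝ),
      s.card = r → (∀ i ∈ s, 0 < y i) → (∀ i ∈ s, ∀ j, 0 ≤ b i j) →
      (∀ i ∈ s, ∀ θ : ℝ, 0 < θ → θ * y i ≤ K * (1 + youngPhi n θ * b i 1)) →
      (∀ i ∈ s, ∀ j, 1 ≤ j → j < r → youngPhi n (b i j) ≤ K * b i (j + 1)) →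
      (∀ i ∈ s, ∀ j, 1 ≤ j → j < r → b i j ≤ b i (j + 1)) →
      c ≤ ∏ i ∈ s, y i → ∏ i ∈ s, y i ≤ C * ∏ i ∈ s, b i r := by
  classical
  induction r with
  | zero =>
    intro c _
    refine ⟨1, one_pos, fun s y b hs _ _ _ _ _ _ => ?_⟩
    rw [Finset.card_eq_zero] at hs
    simp [hs]
  | succ r ih =>
    intro c hc
    obtain ⟨C, hC, hind⟩ := ih (c / (2 * K)) (by positivity)
    have hφ1 := youngPhi_pos n one_pos
    have hφC := youngPhi_pos n hC
    have hφc := youngPhi_pos n (t := 2 * K / c) (by positivity)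
    set C1 : ℝ := (2 * K * youngPhi n 1) ^ (r + 1) with hC1
    set C2 : ℝ := c * (2 ^ (n - 1) * youngPhi n (2 * K / c)) * (2 ^ (n - 1) * youngPhi n C) *
      ((2 ^ (n - 1)) ^ r * youngPhi n 1) * K ^ r with hC2
    have hC10 : 0 < C1 := by positivity
    have hC20 : 0 < C2 := by positivity
    refine ⟨C1 + C2, by positivity, fun s y b hs hy hb hlux hjen hmono hcy => ?_⟩
    have hb1 : ∀ i ∈ s, ∀ j, j ≤ r → b i 1 ≤ b i (j + 1) := by
      intro i hi j
      induction j with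
      | zero => exact fun _ => le_rfl
      | succ j ihj => exact fun hj => (ihj (by omega)).trans (hmono i hi (j + 1) (by omega) (by omega))
    -- Once `θ * y i` reaches `2 * K`, the additive `K` is at most half of the left side and can be
    -- removed.
    have habsorb : ∀ i ∈ s, ∀ θ : ℝ, 0 < θ → 2 * K ≤ θ * y i →
        θ * y i ≤ 2 * K * (youngPhi n θ * b i 1) := by
      intro i hi θ hθ h
      have := hlux i hi θ hθ
      linarith
    have hprod0 : 0 ≤ ∏ i ∈ s, b i (r + 1) := Finset.prod_nonneg fun i hi => hb i hi _
    by_cases hall : ∀ i ∈ s, 2 * K ≤ y i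
    · calc ∏ i ∈ s, y i ≤ ∏ i ∈ s, (2 * K * youngPhi n 1) * b i (r + 1) := by
            refine Finset.prod_le_prod (fun i hi => (hy i hi).le) fun i hi => ?_
            have h1 := habsorb i hi 1 one_pos (by rw [one_mul]; exact hall i hi)
            rw [one_mul, ← mul_assoc] at h1
            exact h1.trans (mul_le_mul_of_nonneg_left (hb1 i hi r le_rfl) (by positivity))
        _ = C1 * ∏ i ∈ s, b i (r + 1) := by
            rw [Finset.prod_mul_distrib, Finset.prod_const, hs]
        _ ≤ _ := by gcongr; linarith
    -- A small factor `y i` forces the product `A` of the others to be at least `c / (2 * K)`, so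
    -- the induction hypothesis bounds `A`. Then `θ = 2 * K / c * A` makes `θ * y i ≥ 2 * K`, and
    -- the resulting `youngPhi n A` raises the remaining modulars from level `r` to `r + 1`.
    · push Not at hall
      obtain ⟨i, hi, hyi⟩ := hall
      set A := ∏ j ∈ s.erase i, y j with hA
      have hyA : ∏ j ∈ s, y j = A * y i := (Finset.prod_erase_mul s y hi).symm
      have hs' : (s.erase i).card = r := by rw [Finset.card_erase_of_mem hi, hs]; omega
      have hsub : ∀ j ∈ s.erase i, j ∈ s := fun j hj => Finset.mem_of_mem_erase hj
      have hyi0 := hy i hi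
      have hA0 : 0 < A := Finset.prod_pos fun j hj => hy j (hsub j hj)
      rw [hyA] at hcy
      have hAc : c / (2 * K) ≤ A := by
        rw [div_le_iff₀ (by positivity)]
        exact hcy.trans (by gcongr)
      have hind' := hind (s.erase i) y b hs' (fun j hj => hy j (hsub j hj))
        (fun j hj => hb j (hsub j hj)) (fun j hj => hlux j (hsub j hj))
        (fun j hj l h1 h2 => hjen j (hsub j hj) l h1 (by omega))
        (fun j hj l h1 h2 => hmono j (hsub j hj) l h1 (by omega)) hAc
      rw [← hA] at hind'
      have hbr0 : ∀ j ∈ s.erase i, 0 ≤ b j r := fun j hj => hb j (hsub j hj) r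
      have hbi0 := hb i hi
      have hprodE : 0 ≤ ∏ j ∈ s.erase i, b j (r + 1) :=
        Finset.prod_nonneg fun j hj => hb j (hsub j hj) _
      have hφA : youngPhi n A ≤ (2 ^ (n - 1) * youngPhi n C) *
          ((2 ^ (n - 1)) ^ r * youngPhi n 1) * K ^ r * ∏ j ∈ s.erase i, b j (r + 1) := by
        calc youngPhi n A ≤ youngPhi n (C * ∏ j ∈ s.erase i, b j r) :=
              youngPhi_mono n hA0.le hind'
          _ ≤ 2 ^ (n - 1) * (youngPhi n C * youngPhi n (∏ j ∈ s.erase i, b j r)) :=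
              youngPhi_mul_le n hC.le (Finset.prod_nonneg hbr0)
          _ ≤ 2 ^ (n - 1) * (youngPhi n C * ((2 ^ (n - 1)) ^ r *
                (youngPhi n 1 * ∏ j ∈ s.erase i, youngPhi n (b j r)))) := by
              gcongr
              have h := youngPhi_prod_le n _ hbr0
              rwa [hs'] at h
          _ ≤ 2 ^ (n - 1) * (youngPhi n C * ((2 ^ (n - 1)) ^ r *
                (youngPhi n 1 * ∏ j ∈ s.erase i, K * b j (r + 1)))) := by
              have h2 : ∏ j ∈ s.erase i, youngPhi n (b j r) ≤
                  ∏ j ∈ s.erase i, K * b j (r + 1) := by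
                refine Finset.prod_le_prod (fun j hj => youngPhi_nonneg n (hbr0 j hj))
                  fun j hj => ?_
                have hr : 1 ≤ r := by
                  rw [← hs']; exact Finset.card_pos.2 ⟨j, hj⟩
                exact hjen j (hsub j hj) r hr (by omega)
              gcongr
          _ = _ := by
              rw [Finset.prod_mul_distrib, Finset.prod_const, hs']; ring
      have hθ0 : 0 < 2 * K / c * A := by positivity
      have hθ := habsorb i hi (2 * K / c * A) hθ0 (by
        rw [mul_assoc, div_mul_eq_mul_div, le_div_iff₀ hc]
        gcongr)
      have hAy : A * y i ≤ c * (youngPhi n (2 * K / c * A) * b i 1) := by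
        have h3 : 2 * K / c * (A * y i) ≤
            2 * K / c * (c * (youngPhi n (2 * K / c * A) * b i 1)) := by
          calc 2 * K / c * (A * y i) = 2 * K / c * A * y i := by ring
            _ ≤ _ := hθ
            _ = _ := by field_simp
        exact le_of_mul_le_mul_left h3 (by positivity)
      have hφA0 := youngPhi_pos n hA0
      rw [hyA]
      calc A * y i ≤ c * (youngPhi n (2 * K / c * A) * b i 1) := hAy
        _ ≤ c * (2 ^ (n - 1) * (youngPhi n (2 * K / c) * youngPhi n A) * b i (r + 1)) := by
            gcongr
            · exact hbi0 1
            · exact youngPhi_mul_le n (by positivity) hA0.le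
            · exact hb1 i hi r le_rfl
        _ ≤ c * (2 ^ (n - 1) * (youngPhi n (2 * K / c) * ((2 ^ (n - 1) * youngPhi n C) *
              ((2 ^ (n - 1)) ^ r * youngPhi n 1) * K ^ r * ∏ j ∈ s.erase i, b j (r + 1))) *
              b i (r + 1)) := by
            gcongr
            exact hbi0 _
        _ = C2 * ∏ j ∈ s, b j (r + 1) := by
            rw [← Finset.prod_erase_mul s _ hi]; ring
        _ ≤ _ := by gcongr; linarith

/-! ### Hölder summation and the bound for finite families -/

theorem list_sum_rpow_le {β : Type*} (L : List β) (w : β → ℝ≥0∞) {s : ℝ} (hs0 : 0 < s)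
    (hs1 : s ≤ 1) : (L.map w).sum ^ s ≤ (L.map fun p => w p ^ s).sum := by
  induction L with
  | nil => simp [hs0]
  | cons p L ih =>
    simp only [List.map_cons, List.sum_cons]
    exact (ENNReal.rpow_add_le_add_rpow _ _ hs0.le hs1).trans (add_le_add le_rfl ih)

/-- Hölder's inequality for a finite sum of products of `m` factors. -/
theorem list_sum_prod_rpow_le {β : Type*} {m : ℕ} (hm : 1 ≤ m) (L : List β)
    (F : Fin m → β → ℝ≥0∞) :
    (L.map fun p => ∏ i, F i p ^ (1 / (m : ℝ))).sum ≤
      ∏ i, (L.map (F i)).sum ^ (1 / (m : ℝ)) := by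
  have hm0 : (m : ℝ) ≠ 0 := by positivity
  have h := ENNReal.lintegral_prod_norm_pow_le (μ := (Measure.count : Measure (Fin L.length)))
    (Finset.univ : Finset (Fin m)) (f := fun i j => F i L[(j : ℕ)]) (p := fun _ => 1 / (m : ℝ))
    (fun i _ => (measurable_of_finite _).aemeasurable) (by simp [hm0])
    (fun _ _ => by positivity)
  simp only [lintegral_count, tsum_fintype] at h
  rw [Fin.sum_univ_fun_getElem L fun p => ∏ i, F i p ^ (1 / (m : ℝ))] at h
  refine h.trans (le_of_eq (Finset.prod_congr rfl fun i _ => ?_))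
  rw [Fin.sum_univ_fun_getElem L (F i)]

/-- Since `s ≤ 1`, the power `s` is subadditive; the `m`-th root of the hypothesis then sums by
Hölder's inequality with equal exponents. -/
theorem list_sum_rpow_le_prod_sum {β : Type*} {m : ℕ} (hm : 1 ≤ m) (L : List β) (w : β → ℝ≥0∞)
    (F : Fin m → β → ℝ≥0∞) {s : ℝ} (hs0 : 0 < s) (hs1 : s ≤ 1)
    (h : ∀ p ∈ L, w p ^ (s * m) ≤ ∏ i, F i p) :
    (L.map w).sum ^ (s * m) ≤ ∏ i, (L.map (F i)).sum := by
  have hm0 : (0 : ℝ) < m := by positivity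
  have hpt : ∀ p ∈ L, w p ^ s ≤ ∏ i, F i p ^ (1 / (m : ℝ)) := by
    intro p hp
    rw [ENNReal.prod_rpow_of_nonneg (by positivity)]
    calc w p ^ s = (w p ^ (s * m)) ^ (1 / (m : ℝ)) := by
          rw [← ENNReal.rpow_mul]; congr 1; field_simp
      _ ≤ _ := ENNReal.rpow_le_rpow (h p hp) (by positivity)
  have hle : (L.map w).sum ^ s ≤ ∏ i, (L.map (F i)).sum ^ (1 / (m : ℝ)) :=
    (list_sum_rpow_le L w hs0 hs1).trans
      ((List.sum_le_sum hpt).trans (list_sum_prod_rpow_le hm L F))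
  rw [ENNReal.prod_rpow_of_nonneg (by positivity)] at hle
  have h2 := ENNReal.rpow_le_rpow hle hm0.le
  rwa [← ENNReal.rpow_mul, ← ENNReal.rpow_mul, one_div, inv_mul_cancel₀ hm0.ne',
    ENNReal.rpow_one] at h2

theorem posLog_rpow {V a : ℝ} (hV : 0 < V) (ha : 0 ≤ a) :
    Real.posLog (V ^ a) = a * Real.posLog V := by
  rw [Real.posLog_apply, Real.posLog_apply, Real.log_rpow hV, mul_max_of_nonneg _ _ ha, mul_zero]

/-- The selected-list bound applied to `θ * g` cut off to `E`, with `θ` split off by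
submultiplicativity. Keeping `θ` free replaces the use of a Luxemburg norm. -/
theorem exists_mul_sum_lintegral_le (k : ℕ) : ∃ K : ℝ, 0 < K ∧
    ∀ (L : List ((Fin (k + 1) → ℝ) × (Fin (k + 1) → ℝ))) (E : Set (Fin (k + 1) → ℝ))
      (g : (Fin (k + 1) → ℝ) → ℝ) (θ : ℝ), SelectedList L → MeasurableSet E →
      (∀ p ∈ L, openBox p ⊆ E) → Measurable g → (∀ x, 0 ≤ g x) → 0 < θ →
      ENNReal.ofReal θ * (L.map fun p => ∫⁻ x in openBox p, ENNReal.ofReal (g x)).sum ≤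
        ENNReal.ofReal K * (volume E + ENNReal.ofReal (youngPhi (k + 1) θ) *
          ∫⁻ x in E, ENNReal.ofReal (youngPhi (k + 1) (g x))) := by
  set Q : ℝ := 2 * 4 ^ k * (2 ^ k * (youngPhi (k + 1) (2 ^ k) * 2 ^ k)) with hQ
  have hφ2 : 0 < youngPhi (k + 1) (2 ^ k) := youngPhi_pos _ (by positivity)
  have hQ0 : 0 < Q := by positivity
  refine ⟨2 * (1 + 10 ^ k * Q), by positivity, fun L E g θ hL hE hLE hg hg0 hθ => ?_⟩
  set F : (Fin (k + 1) → ℝ) → ℝ≥0∞ := E.indicator fun x => ENNReal.ofReal (θ * g x) with hF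
  have hFm : Measurable F := ((hg.const_mul θ).ennreal_ofReal).indicator hE
  have hlhs : ENNReal.ofReal θ * (L.map fun p => ∫⁻ x in openBox p, ENNReal.ofReal (g x)).sum =
      (L.map fun p => ∫⁻ x in openBox p, F x).sum := by
    rw [← List.sum_map_mul_left]
    congr 1
    refine List.map_congr_left fun p hp => ?_
    rw [← lintegral_const_mul _ hg.ennreal_ofReal]
    refine setLIntegral_congr_fun (measurableSet_openBox p) fun x hx => ?_
    simp only [hF]
    rw [indicator_of_mem (hLE p hp hx), ENNReal.ofReal_mul hθ.le]
  have hφθ := youngPhi_nonneg (k + 1) hθ.le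
  have hpt : ∀ x, dyadicSum k (2 ^ k * F x) ≤ E.indicator (fun x => ENNReal.ofReal Q *
      (ENNReal.ofReal (youngPhi (k + 1) θ) * ENNReal.ofReal (youngPhi (k + 1) (g x)))) x := by
    intro x
    by_cases hx : x ∈ E
    · rw [hF, indicator_of_mem hx, indicator_of_mem hx]
      have hθg : 0 ≤ θ * g x := mul_nonneg hθ.le (hg0 x)
      have hφg := youngPhi_nonneg (k + 1) (hg0 x)
      have h2 : (2 : ℝ≥0∞) ^ k * ENNReal.ofReal (θ * g x) =
          ENNReal.ofReal (2 ^ k * (θ * g x)) := by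
        rw [ENNReal.ofReal_mul (p := 2 ^ k) (by positivity), ENNReal.ofReal_pow (by norm_num)]; simp
      rw [h2, ← ENNReal.ofReal_mul hφθ, ← ENNReal.ofReal_mul hQ0.le]
      refine (dyadicSum_ofReal_le k (by positivity)).trans (ENNReal.ofReal_le_ofReal ?_)
      calc 2 * 4 ^ k * youngPhi (k + 1) (2 ^ k * (θ * g x))
          ≤ 2 * 4 ^ k * (2 ^ k * (youngPhi (k + 1) (2 ^ k) * youngPhi (k + 1) (θ * g x))) := by
            gcongr
            exact youngPhi_mul_le (k + 1) (by positivity) hθg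
        _ ≤ 2 * 4 ^ k * (2 ^ k * (youngPhi (k + 1) (2 ^ k) *
              (2 ^ k * (youngPhi (k + 1) θ * youngPhi (k + 1) (g x))))) := by
            gcongr
            exact youngPhi_mul_le (k + 1) hθ.le (hg0 x)
        _ = _ := by rw [hQ]; ring
    · rw [hF, indicator_of_notMem hx, mul_zero, dyadicSum_of_le_one k zero_le_one]
      exact zero_le
  have hφm : Measurable fun x => ENNReal.ofReal (youngPhi (k + 1) (g x)) :=
    ((measurable_youngPhi _).comp hg).ennreal_ofReal
  have hU : (⋃ p ∈ L, openBox p) ⊆ E := iUnion₂_subset hLE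
  rw [hlhs]
  set I := ENNReal.ofReal (youngPhi (k + 1) θ) *
    ∫⁻ x in E, ENNReal.ofReal (youngPhi (k + 1) (g x)) with hI
  calc (L.map fun p => ∫⁻ x in openBox p, F x).sum
      ≤ 2 * (volume (⋃ p ∈ L, openBox p) + 10 ^ k * ∫⁻ x, dyadicSum k (2 ^ k * F x)) :=
        sum_lintegral_le_of_selectedList hL hFm
    _ ≤ 2 * (volume E + 10 ^ k * (ENNReal.ofReal Q * I)) := by
        gcongr
        refine (lintegral_mono hpt).trans (le_of_eq ?_)
        rw [lintegral_indicator hE, lintegral_const_mul _ (hφm.const_mul _),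
          lintegral_const_mul _ hφm]
    _ ≤ 2 * ((1 + 10 ^ k * ENNReal.ofReal Q) * (volume E + I)) := by
        gcongr
        calc volume E + 10 ^ k * (ENNReal.ofReal Q * I)
            ≤ volume E + 10 ^ k * (ENNReal.ofReal Q * I) +
                (I + 10 ^ k * ENNReal.ofReal Q * volume E) := le_self_add
          _ = _ := by ring
    _ = _ := by
        rw [ENNReal.ofReal_mul (p := 2) (by norm_num),
          ENNReal.ofReal_add (p := 1) (by norm_num) (by positivity),
          ENNReal.ofReal_mul (p := 10 ^ k) (by positivity), ENNReal.ofReal_pow (by norm_num)]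
        simp only [ENNReal.ofReal_ofNat, ENNReal.ofReal_one]
        ring

theorem list_sum_ne_top {β : Type*} (L : List β) (w : β → ℝ≥0∞) (h : ∀ p ∈ L, w p ≠ ∞) :
    (L.map w).sum ≠ ∞ := by
  induction L with
  | nil => simp
  | cons p L ih =>
    rw [List.map_cons, List.sum_cons]
    exact ENNReal.add_ne_top.2
      ⟨h p List.mem_cons_self, ih fun q hq => h q (List.mem_cons_of_mem _ hq)⟩

theorem le_list_sum {β : Type*} {L : List β} (w : β → ℝ≥0∞) {p : β} (hp : p ∈ L) :
    w p ≤ (L.map w).sum :=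
  List.single_le_sum (fun _ _ => zero_le) _ (List.mem_map_of_mem hp)

theorem integrable_youngPhi_iterate_const_mul {X : Type*} [MeasurableSpace X] (μ : Measure X)
    (n : ℕ) {j m : ℕ} (hjm : j ≤ m) {c : ℝ} (hc : 0 ≤ c) {h : X → ℝ} (hm : Measurable h)
    (h0 : ∀ x, 0 ≤ h x) (hint : Integrable (fun x => (youngPhi n)^[m] (h x)) μ) :
    Integrable (fun x => (youngPhi n)^[j] (c * h x)) μ := by
  obtain ⟨K, hK, hmul⟩ := exists_youngPhi_iterate_mul_le n j
  refine (hint.const_mul (K * (youngPhi n)^[j] c)).mono'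
    ((measurable_youngPhi_iterate n j).comp (hm.const_mul c)).aestronglyMeasurable
    (Filter.Eventually.of_forall fun x => ?_)
  have hcx := mul_nonneg hc (h0 x)
  rw [Real.norm_of_nonneg (youngPhi_iterate_nonneg n j hcx)]
  refine (hmul c (h x) hc (h0 x)).trans ?_
  have h1 := youngPhi_iterate_nonneg n j hc
  have h2 := youngPhi_iterate_mono_index n hjm (h0 x)
  rw [mul_assoc]
  gcongr

/-- The estimate for a finite family of boxes. -/
theorem exists_finite_family_bound (k m : ℕ) (hm : 1 ≤ m) {a : ℝ} (ha0 : 0 ≤ a) (ha1 : a < 1) :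
    ∃ C : ℝ, 0 < C ∧ ∀ h : Fin m → (Fin (k + 1) → ℝ) → ℝ,
      (∀ i, Measurable (h i)) → (∀ i x, 0 ≤ h i x) →
      (∀ i, Integrable fun x => (youngPhi (k + 1))^[m] (h i x)) →
      ∀ T : Finset ((Fin (k + 1) → ℝ) × (Fin (k + 1) → ℝ)), T.Nonempty →
        (∀ p ∈ T, volume (openBox p) ≠ 0) →
        (∀ p ∈ T, volume (openBox p) ^ ((1 - a) * m) <
          ∏ i, ∫⁻ x in openBox p, ENNReal.ofReal (h i x)) →
        (volume (⋃ p ∈ T, openBox p)).toReal ^ ((1 - a) * m) ≤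
          C * ((1 + (a * Real.posLog (∏ i, ∫ x, (youngPhi (k + 1))^[m] (h i x))) ^ k) ^ (m * m) *
            ∏ i, ∫ x, (youngPhi (k + 1))^[m] (h i x)) := by
  set n := k + 1 with hn
  have hs : 0 < 1 - a := by linarith
  have hm0 : (0 : ℝ) < m := by exact_mod_cast hm
  set σ : ℝ := (1 - a) * m with hσ
  have hσ0 : 0 < σ := mul_pos hs hm0
  obtain ⟨K, hK, hlux⟩ := exists_mul_sum_lintegral_le k
  set J : ℝ := 2 ^ (n - 1) * youngPhi n 2 with hJ
  set c0 : ℝ≥0∞ := 10 ^ (k + 1) * dyadicSum (k + 1) (2 ^ (k + 1) * 4) * 3 with hc0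
  have hc0top : c0 ≠ ∞ := by
    refine ENNReal.mul_ne_top (ENNReal.mul_ne_top (ENNReal.pow_ne_top (by norm_num)) ?_)
      (by norm_num)
    exact dyadicSum_ne_top _ (ENNReal.mul_ne_top (ENNReal.pow_ne_top (by norm_num)) (by norm_num))
  -- The `+ 1` only secures positivity, needed to invert `C0 ^ σ`.
  set C0 : ℝ := c0.toReal + 1 with hC0
  have hC00 : 0 < C0 := by positivity
  have hK' : 0 < max K J := lt_max_of_lt_left hK
  obtain ⟨Cp, hCp, hprod⟩ :=
    exists_prod_le_prod_modular n hK' (Fin m) m (C0 ^ σ)⁻¹ (by positivity)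
  obtain ⟨Km, hKm, hmul⟩ := exists_youngPhi_iterate_mul_le n m
  obtain ⟨Cm, hCm, hgrow⟩ := exists_youngPhi_iterate_le n m
  obtain ⟨C', hC', hboot⟩ := exists_rpow_le_of_rpow_le_log k (m * m) (σ := σ) (a := a)
    (C := Cp * C0 ^ σ * (Km * Cm) ^ m) hσ0 ha0 (by positivity)
  refine ⟨C', hC', fun h hmeas h0 hint T hT hTvol hTlarge => ?_⟩
  set E := ⋃ p ∈ T, openBox p with hE
  have hEm : MeasurableSet E := T.measurableSet_biUnion fun p _ => measurableSet_openBox p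
  have hEtop : volume E ≠ ∞ :=
    (measure_biUnion_lt_top T.finite_toSet fun p _ => (volume_openBox_ne_top p).lt_top).ne
  have hE0 : volume E ≠ 0 := by
    obtain ⟨p, hp⟩ := hT
    intro hzero
    exact hTvol p hp (measure_mono_null (subset_biUnion_of_mem (u := openBox) hp) hzero)
  set V := (volume E).toReal with hV
  have hV0 : 0 < V := ENNReal.toReal_pos hE0 hEtop
  have hVE : volume E = ENNReal.ofReal V := (ENNReal.ofReal_toReal hEtop).symm
  obtain ⟨L, hL, hLT, hcov⟩ := exists_selectedList T
  have hLE : ∀ p ∈ L, openBox p ⊆ E := fun p hp => subset_biUnion_of_mem (u := openBox) (hLT p hp)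
  set X : ℝ≥0∞ := (L.map fun p => volume (openBox p)).sum with hX
  have hXtop : X ≠ ∞ := list_sum_ne_top L _ fun p _ => volume_openBox_ne_top p
  have hVX : volume E ≤ c0 * X := volume_biUnion_le_sum_of_selected hcov
  set Y : Fin m → ℝ≥0∞ := fun i =>
    (L.map fun p => ∫⁻ x in openBox p, ENNReal.ofReal (h i x)).sum with hY
  have hle : ∀ i x, h i x ≤ (youngPhi n)^[m] (h i x) := fun i x =>
    youngPhi_iterate_mono_index n (Nat.zero_le m) (h0 i x)
  have hYtop : ∀ i, Y i ≠ ∞ := fun i => list_sum_ne_top L _ fun p _ => by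
    have h1 : ∫⁻ x, ENNReal.ofReal ((youngPhi n)^[m] (h i x)) ≠ ∞ :=
      (hint i).lintegral_lt_top.ne
    refine ne_top_of_le_ne_top h1 ((setLIntegral_le_lintegral _ _).trans (lintegral_mono fun x => ?_))
    exact ENNReal.ofReal_le_ofReal (hle i x)
  have hY0 : ∀ i, Y i ≠ 0 := by
    have hLne : L ≠ [] := by
      rintro rfl
      simp only [hX, List.map_nil, List.sum_nil, mul_zero] at hVX
      exact hE0 (le_antisymm hVX zero_le)
    obtain ⟨p, hp⟩ := List.exists_mem_of_ne_nil L hLne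
    have h1 := (pos_of_gt (hTlarge p (hLT p hp))).ne'
    intro i hi
    refine (Finset.prod_ne_zero_iff.1 h1) i (Finset.mem_univ i) ?_
    exact le_antisymm ((le_list_sum (fun p => ∫⁻ x in openBox p, ENNReal.ofReal (h i x)) hp).trans
      hi.le) zero_le
  have hXY : X ^ σ ≤ ∏ i, Y i :=
    list_sum_rpow_le_prod_sum hm L (fun p => volume (openBox p))
      (fun i p => ∫⁻ x in openBox p, ENNReal.ofReal (h i x)) hs (by linarith)
      fun p hp => (hTlarge p (hLT p hp)).le
  have hVXr : V ≤ C0 * X.toReal := by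
    have h1 := ENNReal.toReal_mono (ENNReal.mul_ne_top hc0top hXtop) hVX
    rw [ENNReal.toReal_mul] at h1
    refine h1.trans (mul_le_mul_of_nonneg_right ?_ ENNReal.toReal_nonneg)
    rw [hC0]; linarith
  have hXYr : X.toReal ^ σ ≤ ∏ i, (Y i).toReal := by
    rw [ENNReal.toReal_rpow, ← ENNReal.toReal_prod]
    exact ENNReal.toReal_mono (ENNReal.prod_ne_top fun i _ => hYtop i) hXY
  have hVa : 0 < V ^ a := Real.rpow_pos_of_pos hV0 a
  -- The fractional gain is moved into the functions: with this scaling the product of the `y i`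
  -- becomes `V ^ (-σ) * ∏ Y i`, which is bounded below.
  set g : Fin m → (Fin (k + 1) → ℝ) → ℝ := fun i x => V ^ a * h i x with hg
  have hg0 : ∀ i x, 0 ≤ g i x := fun i x => mul_nonneg hVa.le (h0 i x)
  have hgm : ∀ i, Measurable (g i) := fun i => (hmeas i).const_mul _
  have hgint : ∀ i j, j ≤ m →
      Integrable (fun x => (youngPhi n)^[j] (g i x)) (volume.restrict E) := fun i j hj =>
    integrable_youngPhi_iterate_const_mul _ n hj hVa.le (hmeas i) (h0 i) (hint i).restrict
  set b : Fin m → ℕ → ℝ := fun i j => V⁻¹ * ∫ x in E, (youngPhi n)^[j] (g i x) with hb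
  have hint0 : ∀ i j, 0 ≤ ∫ x in E, (youngPhi n)^[j] (g i x) := fun i j =>
    integral_nonneg fun x => youngPhi_iterate_nonneg n j (hg0 i x)
  have hb0 : ∀ i j, 0 ≤ b i j := fun i j => mul_nonneg (by positivity) (hint0 i j)
  set y : Fin m → ℝ := fun i => V ^ a * (Y i).toReal / V with hy
  have hy0 : ∀ i, 0 < y i := fun i =>
    div_pos (mul_pos hVa (ENNReal.toReal_pos (hY0 i) (hYtop i))) hV0
  have hF1 : ∀ i, ∀ θ : ℝ, 0 < θ → θ * y i ≤ max K J * (1 + youngPhi n θ * b i 1) := by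
    intro i θ hθ
    have h1 := hlux L E (g i) θ hL hEm hLE (hgm i) (hg0 i) hθ
    have h2 : (L.map fun p => ∫⁻ x in openBox p, ENNReal.ofReal (g i x)).sum =
        ENNReal.ofReal (V ^ a * (Y i).toReal) := by
      rw [ENNReal.ofReal_mul hVa.le, ENNReal.ofReal_toReal (hYtop i), hY]
      simp only
      rw [← List.sum_map_mul_left]
      congr 1
      refine List.map_congr_left fun p _ => ?_
      rw [← lintegral_const_mul _ (hmeas i).ennreal_ofReal]
      simp only [hg, ENNReal.ofReal_mul hVa.le]
      rfl
    have h3 : ∫⁻ x in E, ENNReal.ofReal (youngPhi n (g i x)) =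
        ENNReal.ofReal (∫ x in E, (youngPhi n)^[1] (g i x)) := by
      rw [ofReal_integral_eq_lintegral_ofReal (hgint i 1 hm)
        (Filter.Eventually.of_forall fun x => youngPhi_iterate_nonneg n 1 (hg0 i x))]
      rfl
    have hφθ := youngPhi_nonneg n hθ.le
    have hI := hint0 i 1
    rw [h2, h3, hVE, ← ENNReal.ofReal_mul hθ.le, ← ENNReal.ofReal_mul hφθ,
      ← ENNReal.ofReal_add hV0.le (by positivity), ← ENNReal.ofReal_mul hK.le,
      ENNReal.ofReal_le_ofReal_iff (by positivity)] at h1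
    have hbi := hb0 i 1
    calc θ * y i = (θ * (V ^ a * (Y i).toReal)) / V := by rw [hy]; ring
      _ ≤ (K * (V + youngPhi n θ * ∫ x in E, (youngPhi n)^[1] (g i x))) / V := by gcongr
      _ = K * (1 + youngPhi n θ * b i 1) := by
          simp only [hb]; field_simp
      _ ≤ _ := by
          gcongr
          exact le_max_left _ _
  have hprob : IsProbabilityMeasure (ProbabilityTheory.cond volume E) :=
    ProbabilityTheory.cond_isProbabilityMeasure_of_finite hE0 hEtop
  have hbcond : ∀ i j,
      ∫ x, (youngPhi n)^[j] (g i x) ∂(ProbabilityTheory.cond volume E) = b i j := by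
    intro i j
    rw [ProbabilityTheory.cond, integral_smul_measure, ENNReal.toReal_inv, smul_eq_mul]
  have hcondint : ∀ i j, j ≤ m →
      Integrable (fun x => (youngPhi n)^[j] (g i x)) (ProbabilityTheory.cond volume E) :=
    fun i j hj => (hgint i j hj).smul_measure (ENNReal.inv_ne_top.2 hE0)
  -- Jensen's inequality for the normalised measure on `E`.
  have hF2 : ∀ i j, j < m → youngPhi n (b i j) ≤ max K J * b i (j + 1) := by
    intro i j hj
    have h1 := youngPhi_integral_le n (ProbabilityTheory.cond volume E)
      (h := fun x => (youngPhi n)^[j] (g i x))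
      (fun x => youngPhi_iterate_nonneg n j (hg0 i x)) (hcondint i j hj.le)
      (by simpa only [← iterate_succ_apply'] using hcondint i (j + 1) hj)
    simp only [← iterate_succ_apply'] at h1
    rw [hbcond, hbcond] at h1
    exact h1.trans (mul_le_mul_of_nonneg_right (le_max_right _ _) (hb0 i _))
  have hF3 : ∀ i j, j < m → b i j ≤ b i (j + 1) := by
    intro i j hj
    refine mul_le_mul_of_nonneg_left ?_ (by positivity)
    exact integral_mono (hgint i j hj.le) (hgint i (j + 1) hj)
      fun x => youngPhi_iterate_le_succ n j (hg0 i x)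
  have hVσ : (V ^ a / V) ^ m = (V ^ σ)⁻¹ := by
    rw [← Real.rpow_neg hV0.le, ← Real.rpow_sub_one hV0.ne', ← Real.rpow_natCast,
      ← Real.rpow_mul hV0.le, hσ]
    congr 1; ring
  have hVσ0 : 0 < V ^ σ := Real.rpow_pos_of_pos hV0 σ
  have hprody : ∏ i, y i = (V ^ σ)⁻¹ * ∏ i, (Y i).toReal := by
    rw [← hVσ, hy]
    simp only [mul_div_right_comm]
    rw [Finset.prod_mul_distrib, Finset.prod_const, Finset.card_univ, Fintype.card_fin]
  have hcy : (C0 ^ σ)⁻¹ ≤ ∏ i, y i := by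
    rw [hprody, inv_eq_one_div, inv_mul_eq_div, div_le_div_iff₀ (by positivity) hVσ0, one_mul]
    calc V ^ σ ≤ (C0 * X.toReal) ^ σ := Real.rpow_le_rpow hV0.le hVXr hσ0.le
      _ = X.toReal ^ σ * C0 ^ σ := by
          rw [Real.mul_rpow hC00.le ENNReal.toReal_nonneg, mul_comm]
      _ ≤ _ := by gcongr
  have hmain := hprod Finset.univ y b (by simp) (fun i _ => hy0 i) (fun i _ => hb0 i)
    (fun i _ => hF1 i) (fun i _ j _ hj => hF2 i j hj) (fun i _ j _ hj => hF3 i j hj) hcy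
  set u : ℝ := 1 + (a * Real.posLog V) ^ k with hu
  have hLV : 0 ≤ Real.posLog V := Real.posLog_nonneg
  have hu0 : 0 ≤ u := by positivity
  set B := ∏ i, ∫ x, (youngPhi n)^[m] (h i x) with hB
  have hI0 : ∀ i, 0 ≤ ∫ x, (youngPhi n)^[m] (h i x) := fun i =>
    integral_nonneg fun x => youngPhi_iterate_nonneg n m (h0 i x)
  have hB0 : 0 ≤ B := Finset.prod_nonneg fun i _ => hI0 i
  have hbm : ∀ i, b i m ≤ V ^ a / V * (Km * Cm * u ^ m * ∫ x, (youngPhi n)^[m] (h i x)) := by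
    intro i
    have h1 : (youngPhi n)^[m] (V ^ a) ≤ Cm * (V ^ a * u ^ m) := by
      have := hgrow (V ^ a) hVa.le
      rwa [posLog_rpow hV0 ha0] at this
    have h2 : ∫ x in E, (youngPhi n)^[m] (g i x) ≤
        Km * (Cm * (V ^ a * u ^ m)) * ∫ x, (youngPhi n)^[m] (h i x) := by
      calc ∫ x in E, (youngPhi n)^[m] (g i x)
          ≤ ∫ x in E, Km * (Cm * (V ^ a * u ^ m)) * (youngPhi n)^[m] (h i x) := by
            refine integral_mono (hgint i m le_rfl) ((hint i).restrict.const_mul _) fun x => ?_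
            refine (hmul (V ^ a) (h i x) hVa.le (h0 i x)).trans ?_
            have h3 := youngPhi_iterate_nonneg n m (h0 i x)
            rw [mul_assoc]
            gcongr
        _ = Km * (Cm * (V ^ a * u ^ m)) * ∫ x in E, (youngPhi n)^[m] (h i x) :=
            integral_const_mul _ _
        _ ≤ _ := by
            gcongr
            · exact Filter.Eventually.of_forall fun x => youngPhi_iterate_nonneg n m (h0 i x)
            · exact hint i
            · exact Measure.restrict_le_self
    calc b i m ≤ V⁻¹ * (Km * (Cm * (V ^ a * u ^ m)) * ∫ x, (youngPhi n)^[m] (h i x)) :=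
          mul_le_mul_of_nonneg_left h2 (by positivity)
      _ = _ := by ring
  -- What remains is the bound with `log⁺ V` on the right. The product being bounded below by `(C0 ^
  -- σ)⁻¹` and above by the modulars, `V ^ σ` is isolated from the scaling factor `(V ^ a / V) ^ m =
  -- (V ^ σ)⁻¹`.
  refine hboot V B hV0 hB0 ?_
  have hfin : (C0 ^ σ)⁻¹ ≤ Cp * ((V ^ σ)⁻¹ * ((Km * Cm) ^ m * u ^ (m * m) * B)) := by
    refine (hcy.trans hmain).trans ?_
    gcongr
    calc ∏ i, b i m
        ≤ ∏ i, V ^ a / V * (Km * Cm * u ^ m * ∫ x, (youngPhi n)^[m] (h i x)) :=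
          Finset.prod_le_prod (fun i _ => hb0 i m) fun i _ => hbm i
      _ = _ := by
          rw [Finset.prod_mul_distrib, Finset.prod_mul_distrib, Finset.prod_const,
            Finset.prod_const, Finset.card_univ, Fintype.card_fin, hVσ, mul_pow _ (u ^ m), pow_mul]
  have hC0σ : 0 < C0 ^ σ := Real.rpow_pos_of_pos hC00 σ
  calc V ^ σ = C0 ^ σ * V ^ σ * (C0 ^ σ)⁻¹ := by field_simp
    _ ≤ C0 ^ σ * V ^ σ * (Cp * ((V ^ σ)⁻¹ * ((Km * Cm) ^ m * u ^ (m * m) * B))) := by gcongr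
    _ = Cp * C0 ^ σ * (Km * Cm) ^ m * (u ^ (m * m) * B) := by field_simp

/-! ### From finite families to the level set -/

theorem ennrealPosLog_ofReal {B : ℝ} (hB : 0 < B) :
    ennrealPosLog (ENNReal.ofReal B) = ENNReal.ofReal (Real.posLog B) := by
  rw [ennrealPosLog, ENNReal.log_ofReal_of_pos hB, EReal.toENNReal_of_ne_top (EReal.coe_ne_top _),
    EReal.toReal_coe, Real.posLog_apply]
  rcases le_total 0 (Real.log B) with h | h
  · rw [max_eq_right h]
  · rw [max_eq_left h, ENNReal.ofReal_zero, ENNReal.ofReal_of_nonpos h]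

/-- The right-hand side of the endpoint estimate in terms of real numbers. -/
theorem ofReal_mul_prod_eq {m k : ℕ} {C a : ℝ} (hC : 0 ≤ C) (ha : 0 ≤ a) {I : Fin m → ℝ}
    (hI : ∀ i, 0 < I i) :
    ENNReal.ofReal C * ∏ i, ((1 + (ENNReal.ofReal a *
        ennrealPosLog (∏ j, ENNReal.ofReal (I j))) ^ k) ^ m * ENNReal.ofReal (I i)) =
      ENNReal.ofReal (C * ((1 + (a * Real.posLog (∏ i, I i)) ^ k) ^ (m * m) * ∏ i, I i)) := by
  have hL : 0 ≤ Real.posLog (∏ i, I i) := Real.posLog_nonneg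
  have hB : 0 < ∏ i, I i := Finset.prod_pos fun i _ => hI i
  rw [← ENNReal.ofReal_prod_of_nonneg (fun i _ => (hI i).le), ennrealPosLog_ofReal hB,
    Finset.prod_mul_distrib, Finset.prod_const, Finset.card_univ, Fintype.card_fin,
    ← ENNReal.ofReal_prod_of_nonneg (fun i _ => (hI i).le), ENNReal.ofReal_mul hC,
    ENNReal.ofReal_mul (by positivity), ENNReal.ofReal_pow (by positivity),
    ENNReal.ofReal_add zero_le_one (by positivity), ENNReal.ofReal_pow (by positivity),
    ENNReal.ofReal_mul ha, ENNReal.ofReal_one, pow_mul]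

theorem mem_levelSet_iff {n m : ℕ} {α lam : ℝ} (hlam : 0 < lam)
    (f : Fin m → (Fin n → ℝ) → ℂ) (h : Fin m → (Fin n → ℝ) → ℝ)
    (hfh : ∀ i (s : Set (Fin n → ℝ)), ∫⁻ x in s, ‖f i x‖ₑ =
      ENNReal.ofReal lam * ∫⁻ x in s, ENNReal.ofReal (h i x)) (x : Fin n → ℝ) :
    ENNReal.ofReal (lam ^ m) < fracStrongMaximal α f x ↔
      ∃ p : (Fin n → ℝ) × (Fin n → ℝ), ((∀ i, p.1 i < p.2 i) ∧
        volume (openBox p) ^ ((1 - α / ((m : ℝ) * (n : ℝ))) * m) <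
          ∏ i, ∫⁻ y in openBox p, ENNReal.ofReal (h i y)) ∧ x ∈ openBox p := by
  have hiff : ∀ p : (Fin n → ℝ) × (Fin n → ℝ), (∀ i, p.1 i < p.2 i) →
      (ENNReal.ofReal (lam ^ m) < ∏ i, (∫⁻ y in openBox p, ‖f i y‖ₑ) /
          volume (openBox p) ^ (1 - α / ((m : ℝ) * (n : ℝ))) ↔
        volume (openBox p) ^ ((1 - α / ((m : ℝ) * (n : ℝ))) * m) <
          ∏ i, ∫⁻ y in openBox p, ENNReal.ofReal (h i y)) := by
    intro p hp
    have hv0 : volume (openBox p) ≠ 0 := by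
      rw [volume_openBox, Finset.prod_ne_zero_iff]
      intro i _
      simpa using hp i
    have hvt := volume_openBox_ne_top p
    generalize 1 - α / ((m : ℝ) * (n : ℝ)) = s
    have hw0 : volume (openBox p) ^ (s * m) ≠ 0 := by
      simp [ENNReal.rpow_eq_zero_iff, hv0, hvt]
    have hwt : volume (openBox p) ^ (s * m) ≠ ∞ := by
      simp [ENNReal.rpow_eq_top_iff, hv0, hvt]
    have hl0 : ENNReal.ofReal lam ^ m ≠ 0 := by simp [hlam]
    have hlt : ENNReal.ofReal lam ^ m ≠ ∞ := by simp
    simp only [hfh, div_eq_mul_inv]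
    rw [Finset.prod_mul_distrib, Finset.prod_mul_distrib, Finset.prod_const, Finset.prod_const,
      Finset.card_univ, Fintype.card_fin, ENNReal.ofReal_pow hlam.le, ← ENNReal.inv_pow,
      ← ENNReal.rpow_mul_natCast, ← div_eq_mul_inv,
      ENNReal.lt_div_iff_mul_lt (Or.inl hw0) (Or.inl hwt), ENNReal.mul_lt_mul_iff_right hl0 hlt]
  simp only [fracStrongMaximal, lt_iSup_iff, exists_prop]
  constructor
  · rintro ⟨R, ⟨⟨c, d, hcd, rfl⟩, hx⟩, hlt⟩
    exact ⟨(c, d), ⟨hcd, (hiff (c, d) hcd).1 hlt⟩, hx⟩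
  · rintro ⟨p, ⟨hp, hlt⟩, hx⟩
    exact ⟨openBox p, ⟨⟨p.1, p.2, hp, rfl⟩, hx⟩, (hiff p hp).2 hlt⟩

/-- An everywhere nonnegative, Borel measurable representative, since slicing and the directional
operators are not stable under mere almost everywhere measurability. -/
theorem exists_normalized_representative {n : ℕ} {f : (Fin n → ℝ) → ℂ}
    (hf : LocallyIntegrable f volume) {lam : ℝ} (hlam : 0 < lam) :
    ∃ h : (Fin n → ℝ) → ℝ, Measurable h ∧ (∀ x, 0 ≤ h x) ∧
      (fun x => ‖f x‖ / lam) =ᵐ[volume] h := by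
  have hm : AEMeasurable (fun x => ‖f x‖ / lam) volume :=
    hf.aestronglyMeasurable.norm.aemeasurable.div_const lam
  refine ⟨fun x => |hm.mk _ x|, hm.measurable_mk.abs, fun x => abs_nonneg _, ?_⟩
  filter_upwards [hm.ae_eq_mk] with x hx
  rw [← hx, abs_of_nonneg (by positivity)]

theorem theorem2p1 (n m : ℕ) (hn : 1 ≤ n) (hm : 1 ≤ m) (α : ℝ) (hα0 : 0 ≤ α)
    (hα : α < (m : ℝ) * (n : ℝ)) :
    ∃ C : ℝ, 0 < C ∧
      ∀ f : Fin m → (Fin n → ℝ) → ℂ, (∀ i, LocallyIntegrable (f i) volume) →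
        ∀ lam : ℝ, 0 < lam →
          volume {x : Fin n → ℝ | ENNReal.ofReal (lam ^ m) < fracStrongMaximal α f x} ^
              ((m : ℝ) - α / (n : ℝ)) ≤
            ENNReal.ofReal C *
              ∏ i, ((1 + (ENNReal.ofReal (α / ((m : ℝ) * (n : ℝ))) *
                  ennrealPosLog (∏ j, youngModular n m lam (f j))) ^ (n - 1)) ^ m *
                youngModular n m lam (f i)) := by
  have hm0 : (0 : ℝ) < m := by exact_mod_cast hm
  have hn0 : (0 : ℝ) < n := by exact_mod_cast hn
  set a : ℝ := α / ((m : ℝ) * (n : ℝ)) with ha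
  have ha0 : 0 ≤ a := by positivity
  have ha1 : a < 1 := (div_lt_one (by positivity)).2 hα
  have hσ : (m : ℝ) - α / (n : ℝ) = (1 - a) * m := by rw [ha]; field_simp
  have hσ0 : 0 < (1 - a) * m := mul_pos (by linarith) hm0
  obtain ⟨k, rfl⟩ : ∃ k, n = k + 1 := ⟨n - 1, by omega⟩
  obtain ⟨C, hC, hcore⟩ := exists_finite_family_bound k m hm ha0 ha1
  refine ⟨C, hC, fun f hf lam hlam => ?_⟩
  choose h hmeas h0 hfh using fun i => exists_normalized_representative (hf i) hlam
  have hmod : ∀ i, youngModular (k + 1) m lam (f i) =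
      ∫⁻ x, ENNReal.ofReal ((youngPhi (k + 1))^[m] (h i x)) := fun i =>
    lintegral_congr_ae ((hfh i).fun_comp fun t => ENNReal.ofReal ((youngPhi (k + 1))^[m] t))
  have hint : ∀ i (s : Set (Fin (k + 1) → ℝ)), ∫⁻ x in s, ‖f i x‖ₑ =
      ENNReal.ofReal lam * ∫⁻ x in s, ENNReal.ofReal (h i x) := by
    intro i s
    rw [← lintegral_const_mul _ (hmeas i).ennreal_ofReal]
    refine lintegral_congr_ae (ae_restrict_of_ae ?_)
    filter_upwards [hfh i] with x hx
    rw [← hx, ← ENNReal.ofReal_mul hlam.le, mul_div_cancel₀ _ hlam.ne', ofReal_norm]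
  rw [hσ]
  set 𝓑 : Set ((Fin (k + 1) → ℝ) × (Fin (k + 1) → ℝ)) := {p | (∀ i, p.1 i < p.2 i) ∧
    volume (openBox p) ^ ((1 - a) * m) < ∏ i, ∫⁻ y in openBox p, ENNReal.ofReal (h i y)} with h𝓑
  have hS : {x | ENNReal.ofReal (lam ^ m) < fracStrongMaximal α f x} = ⋃ p ∈ 𝓑, openBox p := by
    ext x
    simp only [mem_iUnion, exists_prop]
    exact mem_levelSet_iff hlam f h hint x
  rw [hS]
  set D := ENNReal.ofReal C * ∏ i, ((1 + (ENNReal.ofReal a *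
    ennrealPosLog (∏ j, youngModular (k + 1) m lam (f j))) ^ (k + 1 - 1)) ^ m *
      youngModular (k + 1) m lam (f i)) with hD
  have hfinite : ∀ T : Finset ((Fin (k + 1) → ℝ) × (Fin (k + 1) → ℝ)), (T : Set _) ⊆ 𝓑 →
      volume (⋃ p ∈ T, openBox p) ^ ((1 - a) * m) ≤ D := by
    intro T hT
    rcases T.eq_empty_or_nonempty with rfl | hne
    · simp [hσ0]
    -- A box in the family has strictly positive integrals of all `h i`. This rules out the product
    -- `0 * ∞` on the right when some modular is infinite, and makes the real logarithm legitimate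
    -- otherwise.
    have hmod0 : ∀ i, youngModular (k + 1) m lam (f i) ≠ 0 := by
      intro i hi
      obtain ⟨p, hp⟩ := hne
      refine Finset.prod_ne_zero_iff.1 (pos_of_gt (hT hp).2).ne' i (Finset.mem_univ i) ?_
      refine le_antisymm ((setLIntegral_le_lintegral _ _).trans ?_) zero_le
      rw [← hi, hmod i]
      exact lintegral_mono fun x => ENNReal.ofReal_le_ofReal
        (youngPhi_iterate_mono_index (k + 1) (Nat.zero_le m) (h0 i x))
    by_cases htop : ∃ i, youngModular (k + 1) m lam (f i) = ∞
    · obtain ⟨i, hi⟩ := htop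
      suffices hDtop : D = ∞ by rw [hDtop]; exact le_top
      rw [hD, ← Finset.mul_prod_erase _ _ (Finset.mem_univ i), hi]
      have hone : ∀ z : ℝ≥0∞, (1 + z) ^ m ≠ 0 := fun z => pow_ne_zero _ (by simp)
      rw [ENNReal.mul_top (hone _), ENNReal.top_mul, ENNReal.mul_top (by simpa using hC)]
      exact Finset.prod_ne_zero_iff.2 fun j _ => mul_ne_zero (hone _) (hmod0 j)
    · push Not at htop
      have hintegrable : ∀ i, Integrable fun x => (youngPhi (k + 1))^[m] (h i x) := fun i =>
        (lintegral_ofReal_ne_top_iff_integrable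
          ((measurable_youngPhi_iterate _ m).comp (hmeas i)).aestronglyMeasurable
          (Filter.Eventually.of_forall fun x => youngPhi_iterate_nonneg _ m (h0 i x))).1
          ((hmod i).symm.trans_ne (htop i))
      have hreal : ∀ i, youngModular (k + 1) m lam (f i) =
          ENNReal.ofReal (∫ x, (youngPhi (k + 1))^[m] (h i x)) := by
        intro i
        rw [hmod i, ofReal_integral_eq_lintegral_ofReal (hintegrable i)
          (Filter.Eventually.of_forall fun x => youngPhi_iterate_nonneg _ m (h0 i x))]
      have hpos : ∀ i, 0 < ∫ x, (youngPhi (k + 1))^[m] (h i x) := fun i =>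
        ENNReal.ofReal_pos.1 (by rw [← hreal i]; exact (hmod0 i).bot_lt)
      have hvol0 : ∀ p ∈ T, volume (openBox p) ≠ 0 := by
        intro p hp
        rw [volume_openBox, Finset.prod_ne_zero_iff]
        intro i _
        simpa using (hT hp).1 i
      have hE : volume (⋃ p ∈ T, openBox p) ≠ ∞ :=
        (measure_biUnion_lt_top T.finite_toSet fun p _ => (volume_openBox_ne_top p).lt_top).ne
      rw [hD]
      simp_rw [hreal]
      rw [ofReal_mul_prod_eq hC.le ha0 hpos, Nat.add_sub_cancel, ← ENNReal.ofReal_toReal hE,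
        ENNReal.ofReal_rpow_of_nonneg ENNReal.toReal_nonneg hσ0.le]
      exact ENNReal.ofReal_le_ofReal
        (hcore h hmeas h0 hintegrable T hne hvol0 fun p hp => (hT hp).2)
  have hopen : IsOpen (⋃ p ∈ 𝓑, openBox p) := isOpen_biUnion fun p _ => isOpen_openBox p
  -- Inner regularity of the open level set: a compact subset is covered by finitely many boxes, and
  -- the bound `D` does not depend on which.
  rw [← ENNReal.le_rpow_inv_iff hσ0, hopen.measure_eq_iSup_isCompact]
  refine iSup₂_le fun K hK => iSup_le fun hKc => ?_
  obtain ⟨t, ht𝓑, htfin, hKt⟩ := hKc.elim_finite_subcover_image (fun p _ => isOpen_openBox p) hK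
  obtain ⟨T, rfl⟩ := htfin.exists_finset_coe
  rw [ENNReal.le_rpow_inv_iff hσ0]
  exact (ENNReal.rpow_le_rpow (measure_mono hKt) hσ0.le).trans (hfinite T ht𝓑)
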